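/- **Setting.** Consider $n$ closed disks of radius $R>0$ in the Euclidean plane with centers $O_1,\dots,O_n$. A TSPN tour is a closed polygon obtained by choosing a point $P_j$ in each disk and visiting the chosen points in some cyclic order. $|TSPN^*|$ is the minimum length of such a tour. A TSP tour on the centers is a closed polygon visiting the centers in some cyclic order, and $|TSP^*|$ is the minimum length of such a tour. **Theorem.** 1. Let $n\ge 4$ and let the disks be pairwise disjoint. For every optimal TSPN tour $TSPN^*$ at least one of the following is true: - $TSPN^*$ is supported by a straight line (its points $P_j$ are collinear), - $|TSP^*|\le |TSPN^*|+1.999\,Rn$, - $|TSP^*|\le 2\,|TSPN^*|$. 2. ($3.53$-approximation for disjoint uniform disks, up to an additive multiple of $R$ and relative to the routine used for TSP on points.) If the disks are pairwise disjoint, then for every $a\ge 1$, every TSP tour on the centers of length at most $a\,|TSP^*|$ has length at most $3.53\,a\,|TSPN^*|+8aR$. 3. ($6.728$-approximation for possibly overlapping uniform disks, in the same sense.) Let the disks be arbitrary. Select a subfamily $\mathcal I$ of $k$ pairwise disjoint disks greedily: repeatedly select a leftmost remaining disk and delete all disks that intersect it. Let $a\ge1$ and let $T_{\mathcal I}$ be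 a TSP tour on the centers of $\mathcal I$ of length at most $a$ times the optimum for these centers. To each disk of $\mathcal I$, with center $o$, attach the curve consisting of the arc of its boundary circle in the directions between $-\pi/6$ and $\pi/6$, prolonged at both ends by tangent segments of length $(\sqrt3-1)R$ (ending at $o+R(\tfrac12,\pm(2-\tfrac{\sqrt3}{2}))$). Run through these curves in the order of $T_{\mathcal I}$, alternately downwards and upwards, and visit each of the $n$ disks at a point of one of the curves, in the order in which these points are met. Such a TSPN tour of all the disks always exists, and every TSPN tour $T$ obtained in this way satisfies $$|T|\le 6.728\,a\,|TSPN^*|+(8a+4A+B)R,\qquad A=2\left(\tfrac{\pi}{6}+\sqrt3-1\right),\quad B=4-\sqrt3 .$$ -/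

import Mathlib

open scoped Real

/-- The Euclidean plane. -/
abbrev Plane : Type := EuclideanSpace ℝ (Fin 2)

/-- Length of the closed polygon `p 0, p 1, …, p (k - 1), p 0`
(`finRotate k` is the cyclic successor on `Fin k`). -/
noncomputable def cycleLength {k : ℕ} (p : Fin k → Plane) : ℝ :=
  ∑ i, dist (p i) (p (finRotate k i))

/-- The closed disks of radius `R` with centers `O j` are pairwise disjoint. -/
def DisjointDisks {ι : Type*} (O : ι → Plane) (R : ℝ) : Prop :=
  Pairwise fun i j => Disjoint (Metric.closedBall (O i) R) (Metric.closedBall (O j) R)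

/-- A (cyclic) order in which the members of a finite family are visited. -/
abbrev VisitOrder (ι : Type*) [Fintype ι] : Type _ := Fin (Fintype.card ι) ≃ ι

/-- Length of the TSP tour on the points `O j` that visits them in the order `σ`. -/
noncomputable def tspLength {ι : Type*} [Fintype ι] (O : ι → Plane) (σ : VisitOrder ι) : ℝ :=
  cycleLength fun s => O (σ s)

/-- Length of an optimal TSP tour on the points `O j` (a minimum over finitely many orders). -/
noncomputable def tspOpt {ι : Type*} [Fintype ι] (O : ι → Plane) : ℝ :=
  ⨅ σ : VisitOrder ι, tspLength O σ

/-- A TSPN tour on the disks of radius `R` with centers `O j`: an order of the disks and a point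
chosen in each of them; the tour is the closed polygon through these points in that order. -/
structure TSPNTour {ι : Type*} [Fintype ι] (O : ι → Plane) (R : ℝ) where
  order : VisitOrder ι
  point : ι → Plane
  mem_disk : ∀ j, point j ∈ Metric.closedBall (O j) R

namespace TSPNTour

variable {ι : Type*} [Fintype ι] {O : ι → Plane} {R : ℝ}

/-- Length of a TSPN tour. -/
noncomputable def length (T : TSPNTour O R) : ℝ :=
  cycleLength fun s => T.point (T.order s)

/-- The tour is supported by a straight line. -/
def SupportedByLine (T : TSPNTour O R) : Prop :=
  Collinear ℝ (Set.range T.point)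

end TSPNTour

/-- Length of an optimal TSPN tour on the disks of radius `R` with centers `O j`. -/
noncomputable def tspnOpt {ι : Type*} [Fintype ι] (O : ι → Plane) (R : ℝ) : ℝ :=
  ⨅ T : TSPNTour O R, T.length

/-- `T` is an optimal TSPN tour. -/
def TSPNTour.IsOptimal {ι : Type*} [Fintype ι] {O : ι → Plane} {R : ℝ}
    (T : TSPNTour O R) : Prop :=
  T.length = tspnOpt O R

/-- Optimal TSPN tours exist, so that `tspnOpt` is a minimum. -/
theorem TSPNTour.exists_isOptimal {ι : Type*} [Fintype ι] (O : ι → Plane) {R : ℝ}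
    (hR : 0 ≤ R) : ∃ T : TSPNTour O R, T.IsOptimal := by
  classical
  have hne : Nonempty (VisitOrder ι) := ⟨(Fintype.equivFin ι).symm⟩
  let K : Set (ι → Plane) := Set.univ.pi fun j => Metric.closedBall (O j) R
  have hK : IsCompact K := isCompact_univ_pi fun j => isCompact_closedBall (O j) R
  have hKne : K.Nonempty := ⟨O, fun j _ => Metric.mem_closedBall_self hR⟩
  have key : ∀ σ : VisitOrder ι, ∃ P ∈ K, ∀ Q ∈ K,
      cycleLength (fun s => P (σ s)) ≤ cycleLength (fun s => Q (σ s)) := by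
    intro σ
    have hc : Continuous fun P : ι → Plane => cycleLength (fun s => P (σ s)) := by
      unfold cycleLength
      fun_prop
    obtain ⟨P, hP, hmin⟩ := hK.exists_isMinOn hKne hc.continuousOn
    exact ⟨P, hP, fun Q hQ => hmin hQ⟩
  choose P hP hmin using key
  obtain ⟨σ, hσ⟩ := Finite.exists_min fun σ : VisitOrder ι => cycleLength (fun s => P σ (σ s))
  let T : TSPNTour O R := ⟨σ, P σ, fun j => hP σ j (Set.mem_univ j)⟩
  have hT : ∀ T' : TSPNTour O R, T.length ≤ T'.length := fun T' =>
    (hσ T'.order).trans (hmin T'.order T'.point fun j _ => T'.mem_disk j)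
  have : Nonempty (TSPNTour O R) := ⟨T⟩
  exact ⟨T, le_antisymm (le_ciInf hT) (ciInf_le ⟨T.length, by rintro _ ⟨T', rfl⟩; exact hT T'⟩ T)⟩

open Classical in
/-- `GreedyDisjoint O R S I`: running the left-to-right greedy procedure on the disks with index in
`S` (select a leftmost disk, delete every disk that intersects it, continue with the remaining
ones) can select exactly the disks with index in `I`. Ties are broken arbitrarily. -/
inductive GreedyDisjoint {ι : Type*} (O : ι → Plane) (R : ℝ) : Finset ι → Finset ι → Prop
  | nil : GreedyDisjoint O R ∅ ∅
  | select (S I : Finset ι) (i : ι) (mem : i ∈ S) (leftmost : ∀ j ∈ S, O i 0 ≤ O j 0)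
      (rest : GreedyDisjoint O R
        (S.filter fun j => Disjoint (Metric.closedBall (O i) R) (Metric.closedBall (O j) R)) I) :
      GreedyDisjoint O R S (insert i I)

/-- The curve attached to a selected disk with center `o`: the arc of its boundary circle in the
directions between `-π/6` and `π/6`, prolonged at both ends by tangent segments of length
`(√3 - 1) R`. Its length is `2 (π/6 + √3 - 1) R`, its endpoints are `(4 - √3) R` apart, and the
second coordinate is strictly monotone along it. -/
noncomputable def sideCurve (o : Plane) (R : ℝ) : Set Plane :=
  {p | p ∈ Metric.sphere o R ∧ o 0 + √3 / 2 * R ≤ p 0} ∪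
    segment ℝ (o + R • !₂[√3 / 2, 1 / 2]) (o + R • !₂[1 / 2, 2 - √3 / 2]) ∪
    segment ℝ (o + R • !₂[√3 / 2, -(1 / 2)]) (o + R • !₂[1 / 2, -(2 - √3 / 2)])

/-- `T` is obtained from the TSP tour `τ` on the centers of the selected disks `I` by augmentation:
the side curves of the selected disks are run through one after the other in the order `τ`,
the first one downwards, the second one upwards, and so on alternately, and every
disk of the whole family is visited at a point of one of these curves, in the order in which the
points are met (the disk `j` is visited while the curve at position `pos j` of `τ` is traversed). -/
def IsAugmentation {ι : Type*} [Fintype ι] {O : ι → Plane} {R : ℝ} {I : Finset ι}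
    (τ : VisitOrder I) (T : TSPNTour O R) : Prop :=
  ∃ pos : ι → Fin (Fintype.card I),
    (∀ j, T.point j ∈ sideCurve (O (τ (pos j))) R) ∧
    ∀ s t, s < t →
      pos (T.order s) < pos (T.order t) ∨
      (pos (T.order s) = pos (T.order t) ∧
        if Even (pos (T.order s) : ℕ) then
          T.point (T.order t) 1 ≤ T.point (T.order s) 1
        else T.point (T.order s) 1 ≤ T.point (T.order t) 1)

/-! Scale to R = 1 and let `P i` be the tour point in the disk with center `O i`. Replacing points
by centers in the same order lengthens every edge by at most 2. The unused part of this 2 is the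
loss of the edge, and the first two claims rest on lower bounds for losses.

Two consecutive edges of lengths e, f cannot both have small loss. Seen from their common tour
point, the far centers lie within 1 + e and 1 + f and are at least 2 apart, so the parallelogram law
bounds the vector towards which the common center would have to be opposite. Averaged over all
vertices this gives 1.1 L + 1.9 n for the tour through the centers, where L is the TSPN length. The
unit disks lie in the 2-neighbourhood of the tour points, so an area count gives π n ≤ 4π + 4L.
Eliminating n yields 3.53 L + 8 (for n ≤ 4 the bound L + 2n suffices).

For the trichotomy, the two metric alternatives already exhaust all cases. If L ≥ 2n, then L + 2n ≤
2L. Otherwise short edges are frequent, and near each of them a fixed amount is lost: a loss below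
0.015 at a vertex with short edges forces their lengths to differ by more than 1.5, so a locally
shortest edge is at most one step away. If an angle at its ends is at least 60°, first-order
optimality (w points along the bisector) creates loss; if both are smaller, exchanging the two ends
shortens the tour (`loss_of_local_min`, `loss_near_short_edge`).

For overlapping disks, every disk meets a greedily selected disk weakly to its left, hence meets the
side curve of that disk. Running the curves alternately down and up makes each connecting segment a
translate of a center-to-center segment. The walk therefore costs the TSP tour, plus A R per curve,
plus one closing correction B R. The area count applied to the selected disks bounds their number,
and 3.53 + 3.198 = 6.728. -/

section LocalGeometry

/-! ### Loss at a single vertex: w runs from the center to the tour point, u and v from the tour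
point to the far centers. -/

variable {V : Type*} [NormedAddCommGroup V] [InnerProductSpace ℝ V]

/-- Two long detours sharing a vertex `w` of the unit ball cannot both be tight when their far ends
are at least `2` apart. -/
theorem sub_sqrt_le_pair_loss {w u v : V} {p q M : ℝ} (hw : ‖w‖ ≤ 1) (hu : ‖u‖ ≤ p)
    (hv : ‖v‖ ≤ q) (huv : 2 ≤ ‖u - v‖) (hp : p ≤ M) (hq : q ≤ M) :
    p + q - √(2 * p ^ 2 + 2 * q ^ 2 - 4) ≤ (1 + M) * (2 + p + q - ‖w + u‖ - ‖w + v‖) := by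
  have hp0 := (norm_nonneg u).trans hu
  have hq0 := (norm_nonneg v).trans hv
  have hw0 := norm_nonneg w
  have hA : ‖w + u‖ ≤ 1 + p := (norm_add_le _ _).trans (by linarith)
  have hB : ‖w + v‖ ≤ 1 + q := (norm_add_le _ _).trans (by linarith)
  have hA0 := norm_nonneg (w + u)
  have hB0 := norm_nonneg (w + v)
  have hA2 := norm_add_sq_real w u
  have hB2 := norm_add_sq_real w v
  have hin : inner ℝ w u + inner ℝ w v ≤ ‖u + v‖ := by
    rw [← inner_add_right]
    calc inner ℝ w (u + v) ≤ ‖w‖ * ‖u + v‖ := real_inner_le_norm _ _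
      _ ≤ 1 * ‖u + v‖ := by gcongr
      _ = _ := one_mul _
  have hpar := parallelogram_law_with_norm ℝ u v
  have hu2 : ‖u‖ ^ 2 ≤ p ^ 2 := by gcongr
  have hv2 : ‖v‖ ^ 2 ≤ q ^ 2 := by gcongr
  have hw2 : ‖w‖ ^ 2 ≤ 1 := pow_le_one₀ hw0 hw
  have hs : ‖u + v‖ ≤ √(2 * p ^ 2 + 2 * q ^ 2 - 4) := by
    apply Real.le_sqrt_of_sq_le
    nlinarith
  have h1 : (1 + p) ^ 2 - ‖w + u‖ ^ 2 ≤ 2 * (1 + M) * (1 + p - ‖w + u‖) := by nlinarith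
  have h2 : (1 + q) ^ 2 - ‖w + v‖ ^ 2 ≤ 2 * (1 + M) * (1 + q - ‖w + v‖) := by nlinarith
  nlinarith

/-- When e + f < 2 both radii are at most 3, so M = 3 is admissible. For a fixed sum e + f the
square root is largest when one of the lengths vanishes, and the linear bound on it is tight there
at e + f = 2. -/
theorem pair_loss_ge {w u v : V} {e f : ℝ} (he : 0 ≤ e) (hf : 0 ≤ f) (hw : ‖w‖ ≤ 1)
    (hu : ‖u‖ ≤ 1 + e) (hv : ‖v‖ ≤ 1 + f) (huv : 2 ≤ ‖u - v‖) :
    ‖w + u‖ + ‖w + v‖ ≤ 4 + (e + f) - 0.1 * (2 - (e + f)) := by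
  have hA : ‖w + u‖ ≤ 2 + e := (norm_add_le _ _).trans (by linarith)
  have hB : ‖w + v‖ ≤ 2 + f := (norm_add_le _ _).trans (by linarith)
  rcases le_or_gt 2 (e + f) with h | h
  · linarith
  have key := sub_sqrt_le_pair_loss (M := 3) hw hu hv huv (by linarith) (by linarith)
  have hs : √(2 * (1 + e) ^ 2 + 2 * (1 + f) ^ 2 - 4) ≤ 1.4 * (2 + e + f) - 1.6 := by
    apply Real.sqrt_le_iff.2 ⟨by linarith, ?_⟩
    nlinarith [mul_nonneg he hf]
  linarith

/-- The radicand with p = 1 + e, q = 1 + f is (p + q)² + (p - q)² - 4, so the root comes close to p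
+ q only if |p - q| is nearly 2. With M = 4 the allowed deficit is 5 · 0.015 = 0.075, and p + q ≤ 8
leaves (p - q)² > 1.5². -/
theorem lt_abs_sub_of_pair_loss_lt {w u v : V} {e f : ℝ} (he : 0 ≤ e) (hf : 0 ≤ f)
    (he3 : e ≤ 3) (hf3 : f ≤ 3) (hw : ‖w‖ ≤ 1)
    (hu : ‖u‖ ≤ 1 + e) (hv : ‖v‖ ≤ 1 + f) (huv : 2 ≤ ‖u - v‖)
    (hloss : 4 + (e + f) - ‖w + u‖ - ‖w + v‖ < 0.015) : 1.5 < |e - f| := by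
  have key := sub_sqrt_le_pair_loss (M := 4) hw hu hv huv (by linarith) (by linarith)
  have hs : 2 + e + f - 0.075 ≤ √(2 * (1 + e) ^ 2 + 2 * (1 + f) ^ 2 - 4) := by linarith
  rw [Real.le_sqrt' (by linarith)] at hs
  apply lt_of_pow_lt_pow_left₀ 2 (abs_nonneg _)
  rw [sq_abs]
  nlinarith

/-- The loss on an edge of length `e` leaving the disk in direction `a`, where `⟪a, w⟫ ≤ √3 / 2`. -/
theorem norm_add_smul_le_of_inner_le {w a : V} {e : ℝ} (hw : ‖w‖ ≤ 1) (ha : ‖a‖ = 1)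
    (he : 0.2 ≤ e) (h : inner ℝ w a ≤ 0.8661) : ‖w + e • a‖ ≤ 1 + e - 0.015 := by
  apply abs_le_of_sq_le_sq' _ (by linarith) |>.2
  rw [norm_add_sq_real, inner_smul_right, norm_smul, ha, Real.norm_of_nonneg (by linarith)]
  have hw2 : ‖w‖ ^ 2 ≤ 1 := pow_le_one₀ (norm_nonneg _) hw
  nlinarith

/-- First-order optimality at a vertex with unit directions `a`, `b` to its neighbours. -/
theorem norm_le_inner_of_forall_inner_le {w g : V} (h : ∀ y : V, ‖y‖ ≤ 1 → inner ℝ g (y - w) ≤ 0) :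
    ‖g‖ ≤ inner ℝ g w := by
  rcases eq_or_ne g 0 with rfl | hg
  · simp
  have hg' : ‖g‖ ≠ 0 := norm_ne_zero_iff.2 hg
  have := h (‖g‖⁻¹ • g) (by rw [norm_smul, norm_inv, norm_norm, inv_mul_cancel₀ hg'])
  rw [inner_sub_right, inner_smul_right, real_inner_self_eq_norm_sq, sq, ← mul_assoc,
    inv_mul_cancel₀ hg', one_mul] at this
  linarith

/-- If the angle at an optimal vertex is at least `60°`, one of the two detours is not tight. -/
theorem wide_vertex_loss {w a b : V} {e f : ℝ} (hw : ‖w‖ ≤ 1) (ha : ‖a‖ = 1) (hb : ‖b‖ = 1)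
    (he : 0 < e) (hf : 0 < f) (hab : inner ℝ a b ≤ (1 / 2 : ℝ))
    (hopt : ‖a + b‖ ≤ inner ℝ (a + b) w)
    (hne : 1 ≤ ‖w + e • a‖) (hnf : 1 ≤ ‖w + f • b‖) (hlong : 0.2 ≤ max e f) :
    0.015 ≤ 2 + e + f - ‖w + e • a‖ - ‖w + f • b‖ := by
  have tri : ∀ (x : V) (t : ℝ), ‖x‖ = 1 → 0 < t → ‖w + t • x‖ ≤ 1 + t := fun x t hx ht => by
    refine (norm_add_le _ _).trans ?_
    rw [norm_smul, hx, Real.norm_of_nonneg ht.le]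
    linarith
  have hta := tri a e ha he
  have htb := tri b f hb hf
  -- For a straight angle optimality does not determine w; it suffices that w has a nonpositive
  -- component along one of two opposite directions. If one edge is shorter than 0.2, the other must
  -- supply the loss.
  by_cases hg : a + b = 0
  · have hba : b = -a := (neg_eq_of_add_eq_zero_right hg).symm
    have hib : inner ℝ w b = -inner ℝ w a := by rw [hba, inner_neg_right]
    have hw2 : ‖w‖ ^ 2 ≤ 1 := pow_le_one₀ (norm_nonneg _) hw
    -- an edge pointing into the disk is long or almost tangent
    have aux : ∀ (x : V) (t : ℝ), ‖x‖ = 1 → 0 < t → t < 0.2 → 1 ≤ ‖w + t • x‖ →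
        -0.1 ≤ inner ℝ w x := by
      intro x t hx ht ht2 h1
      have h2 : 1 ≤ ‖w + t • x‖ ^ 2 := one_le_pow₀ h1
      rw [norm_add_sq_real, inner_smul_right, norm_smul, hx, Real.norm_of_nonneg ht.le] at h2
      nlinarith
    by_cases hea : e < 0.2
    · have := aux a e ha he hea hne
      have hf' : 0.2 ≤ f := (le_max_iff.1 hlong).resolve_left hea.not_ge
      have := norm_add_smul_le_of_inner_le hw hb hf' (by linarith)
      linarith
    by_cases hfb : f < 0.2
    · have := aux b f hb hf hfb hnf
      have := norm_add_smul_le_of_inner_le hw ha (not_lt.1 hea) (by linarith)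
      linarith
    rcases le_total (inner ℝ w a) 0 with h | h
    · have := norm_add_smul_le_of_inner_le hw ha (not_lt.1 hea) (by linarith)
      linarith
    · have := norm_add_smul_le_of_inner_le hw hb (not_lt.1 hfb) (by linarith)
      linarith
  · have hgpos : 0 < ‖a + b‖ := norm_pos_iff.2 hg
    have hCS := real_inner_le_norm (a + b) w
    -- Equality in Cauchy–Schwarz: w is a unit vector along the bisector of a and b. Its component
    -- along each of them is |a + b| / 2, which is at most √3 / 2 when the angle is at least 60°.
    have heq : inner ℝ (a + b) w = ‖a + b‖ * ‖w‖ :=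
      le_antisymm hCS (by nlinarith)
    have hw1 : ‖w‖ = 1 := by nlinarith
    have hpar := (inner_eq_norm_mul_iff_real).1 heq
    have hsq : ‖a + b‖ ^ 2 = 2 + 2 * inner ℝ a b := by
      rw [norm_add_sq_real, ha, hb]; ring
    have hle : ‖a + b‖ ≤ 1.7322 := by
      apply abs_le_of_sq_le_sq' _ (by norm_num) |>.2
      rw [hsq]; norm_num; linarith
    have hwa : inner ℝ w a = ‖a + b‖ / 2 := by
      have h1 : inner ℝ (‖w‖ • (a + b)) a = inner ℝ (‖a + b‖ • w) a := by rw [hpar]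
      rw [hw1, one_smul, inner_add_left, inner_smul_left, real_inner_self_eq_norm_sq, ha,
        real_inner_comm] at h1
      simp only [conj_trivial] at h1
      have h2 : ‖a + b‖ * (‖a + b‖ / 2 - inner ℝ w a) = 0 := by
        nlinarith
      rcases mul_eq_zero.1 h2 with h | h <;> linarith
    have hwb : inner ℝ w b = ‖a + b‖ / 2 := by
      have h1 : inner ℝ (‖w‖ • (a + b)) b = inner ℝ (‖a + b‖ • w) b := by rw [hpar]
      rw [hw1, one_smul, inner_add_left, inner_smul_left, real_inner_self_eq_norm_sq, hb] at h1
      simp only [conj_trivial] at h1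
      have h2 : ‖a + b‖ * (‖a + b‖ / 2 - inner ℝ w b) = 0 := by
        nlinarith
      rcases mul_eq_zero.1 h2 with h | h <;> linarith
    by_cases hea : e < 0.2
    · have hf' : 0.2 ≤ f := (le_max_iff.1 hlong).resolve_left hea.not_ge
      have := norm_add_smul_le_of_inner_le hw hb hf' (by linarith)
      linarith
    · have := norm_add_smul_le_of_inner_le hw ha (not_lt.1 hea) (by linarith)
      linarith

/-- The side opposite an angle below 60° is shorter than the longer of the other two sides. -/
theorem norm_sub_lt_of_narrow {x y : V} {a b : V} {e f : ℝ} (hx : x = e • a) (hy : y = f • b)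
    (ha : ‖a‖ = 1) (hb : ‖b‖ = 1) (he : 0 < e) (hf : 0 < f) (hfe : f ≤ e)
    (hab : (1 / 2 : ℝ) < inner ℝ a b) : ‖x - y‖ < e := by
  apply lt_of_pow_lt_pow_left₀ 2 he.le
  rw [norm_sub_sq_real, hx, hy, norm_smul, norm_smul, ha, hb, inner_smul_left, inner_smul_right,
    Real.norm_of_nonneg he.le, Real.norm_of_nonneg hf.le]
  simp only [conj_trivial]
  nlinarith [mul_pos he hf, mul_pos (mul_pos he hf) (sub_pos.2 hab)]

/-- One-sided first variation of the distance. -/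
theorem norm_add_smul_le {x v : V} (hx : x ≠ 0) {t : ℝ} :
    ‖x + t • v‖ ≤ ‖x‖ + t * (inner ℝ x v / ‖x‖) + t ^ 2 * (‖v‖ ^ 2 / (2 * ‖x‖)) := by
  have hx' : 0 < ‖x‖ := norm_pos_iff.2 hx
  have h1 : ‖x + t • v‖ ^ 2 = ‖x‖ ^ 2 + 2 * t * inner ℝ x v + t ^ 2 * ‖v‖ ^ 2 := by
    rw [norm_add_sq_real, inner_smul_right, norm_smul, mul_pow, Real.norm_eq_abs, sq_abs]; ring
  have h2 : ‖x + t • v‖ ≤ (‖x + t • v‖ ^ 2 + ‖x‖ ^ 2) / (2 * ‖x‖) := by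
    rw [le_div_iff₀ (by positivity)]
    nlinarith [sq_nonneg (‖x + t • v‖ - ‖x‖)]
  refine h2.trans (le_of_eq ?_)
  rw [h1]
  field_simp
  ring

/-- A point `x` of a convex set minimizing the sum of distances to `A` and `B`. -/
theorem inner_le_zero_of_forall_dist_add_le {x A B y : V} (hA : A ≠ x) (hB : B ≠ x)
    (hmin : ∀ t : ℝ, 0 < t → t ≤ 1 → dist A x + dist x B ≤
      dist A (x + t • (y - x)) + dist (x + t • (y - x)) B) :
    inner ℝ (‖A - x‖⁻¹ • (A - x) + ‖B - x‖⁻¹ • (B - x)) (y - x) ≤ 0 := by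
  set v := y - x
  have hA' : x - A ≠ 0 := sub_ne_zero.2 hA.symm
  have hB' : x - B ≠ 0 := sub_ne_zero.2 hB.symm
  set K := ‖v‖ ^ 2 / (2 * ‖x - A‖) + ‖v‖ ^ 2 / (2 * ‖x - B‖)
  set s := inner ℝ (x - A) v / ‖x - A‖ + inner ℝ (x - B) v / ‖x - B‖ with hs
  have hK : 0 ≤ K := by positivity
  have key : ∀ t : ℝ, 0 < t → t ≤ 1 → 0 ≤ s + t * K := by
    intro t ht ht1
    have h := hmin t ht ht1
    rw [dist_comm A x, dist_comm A, dist_eq_norm, dist_eq_norm, dist_eq_norm, dist_eq_norm,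
      add_sub_right_comm, add_sub_right_comm] at h
    have h1 := norm_add_smul_le (v := v) hA' (t := t)
    have h2 := norm_add_smul_le (v := v) hB' (t := t)
    have : 0 ≤ t * (s + t * K) := by
      simp only [s, K]
      linarith
    exact nonneg_of_mul_nonneg_right this ht
  have hs0 : 0 ≤ s := by
    by_contra hneg
    push Not at hneg
    -- This t makes the quadratic term at most -s / 2; K + 1 in place of K keeps the denominator
    -- positive when K = 0.
    have h1 := key (min 1 (-s / (2 * (K + 1)))) (by
      apply lt_min one_pos; apply div_pos <;> linarith) (min_le_left _ _)
    have h2 : min 1 (-s / (2 * (K + 1))) * K ≤ -s / (2 * (K + 1)) * K := by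
      gcongr; exact min_le_right _ _
    have h3 : -s / (2 * (K + 1)) * K ≤ -s / 2 := by
      rw [div_mul_eq_mul_div, div_le_div_iff₀ (by linarith) (by norm_num)]
      nlinarith
    linarith
  have : inner ℝ (‖A - x‖⁻¹ • (A - x) + ‖B - x‖⁻¹ • (B - x)) v = -s := by
    rw [inner_add_left, inner_smul_left, inner_smul_left, ← neg_sub x A, ← neg_sub x B,
      inner_neg_left, inner_neg_left, norm_neg, norm_neg, hs]
    simp only [conj_trivial]
    ring
  linarith

end LocalGeometry

/-! ### Area of a neighbourhood of a path, and the number of disjoint disks it can touch. -/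

section Area

open MeasureTheory

/-- The difference of two balls of radius `r` with centers on a horizontal line. -/
theorem volume_closedBall_diff_le_of_horizontal (a : Plane) {d r : ℝ} (hd : 0 ≤ d) (hr : 0 ≤ r) :
    volume (Metric.closedBall (a + EuclideanSpace.single 0 d) r \ Metric.closedBall a r) ≤
      ENNReal.ofReal (2 * r * d) := by
  set S := Metric.closedBall (a + EuclideanSpace.single 0 d) r \ Metric.closedBall a r with hS
  have hSm : MeasurableSet S := Metric.isClosed_closedBall.measurableSet.diff
    Metric.isClosed_closedBall.measurableSet
  -- pass to `ℝ × ℝ` with the vertical coordinate first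
  let F : ℝ × ℝ → Plane := fun z => !₂[z.2, z.1]
  have hF : MeasurePreserving F (volume.prod volume) volume := by
    have h1 := (volume_preserving_finTwoArrow ℝ).symm
    have h2 := PiLp.volume_preserving_toLp (Fin 2)
    have h3 : MeasurePreserving (Prod.swap : ℝ × ℝ → ℝ × ℝ) (volume.prod volume)
      (volume.prod volume) := Measure.measurePreserving_swap
    exact (h2.comp h1).comp h3
  rw [← hF.measure_preimage hSm.nullMeasurableSet,
    Measure.prod_apply (hF.measurable hSm)]
  have hmem : ∀ (y x : ℝ), (y, x) ∈ F ⁻¹' S ↔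
      ((x - a 0 - d) ^ 2 + (y - a 1) ^ 2 ≤ r ^ 2 ∧ r ^ 2 < (x - a 0) ^ 2 + (y - a 1) ^ 2) := by
    intro y x
    simp only [Set.mem_preimage, hS, Set.mem_sdiff, Metric.mem_closedBall, F]
    rw [EuclideanSpace.dist_eq, EuclideanSpace.dist_eq, Real.sqrt_le_left hr, not_le,
      Real.lt_sqrt hr]
    simp [Fin.sum_univ_two, Real.dist_eq, sq_abs, sub_sub]
  calc ∫⁻ y, volume (Prod.mk y ⁻¹' (F ⁻¹' S))
      ≤ ∫⁻ y, (Set.Icc (a 1 - r) (a 1 + r)).indicator (fun _ => ENNReal.ofReal d) y := by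
        apply lintegral_mono
        intro y
        by_cases hy : y ∈ Set.Icc (a 1 - r) (a 1 + r)
        · simp only [Set.indicator_of_mem hy]
          set h := √(r ^ 2 - (y - a 1) ^ 2) with hh
          have hnn : 0 ≤ r ^ 2 - (y - a 1) ^ 2 := by
            obtain ⟨h1, h2⟩ := hy; nlinarith
          have hh2 : h ^ 2 = r ^ 2 - (y - a 1) ^ 2 := Real.sq_sqrt hnn
          have hh0 : 0 ≤ h := Real.sqrt_nonneg _
          -- A horizontal slice of the difference lies between the right ends of the two chords,
          -- which are d apart.
          have hsub : Prod.mk y ⁻¹' (F ⁻¹' S) ⊆ Set.Icc (a 0 + h) (a 0 + d + h) := by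
            intro x hx
            obtain ⟨h1, h2⟩ := (hmem y x).1 hx
            have h3 : (x - a 0 - d) ^ 2 ≤ h ^ 2 := by linarith
            have h4 : h ^ 2 < (x - a 0) ^ 2 := by linarith
            obtain ⟨h5, h6⟩ := abs_le_of_sq_le_sq' h3 hh0
            refine ⟨?_, by linarith⟩
            by_contra hlt
            push Not at hlt
            nlinarith
          refine (measure_mono hsub).trans (le_of_eq ?_)
          rw [Real.volume_Icc]
          congr 1; ring
        · have : Prod.mk y ⁻¹' (F ⁻¹' S) = ∅ := by
            ext x
            simp only [Set.mem_empty_iff_false, iff_false]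
            intro hx
            obtain ⟨h1, -⟩ := (hmem y x).1 hx
            apply hy
            have h2 : (y - a 1) ^ 2 ≤ r ^ 2 := by nlinarith [sq_nonneg (x - a 0 - d)]
            obtain ⟨h3, h4⟩ := abs_le_of_sq_le_sq' h2 hr
            constructor <;> linarith
          simp [this]
    _ = ENNReal.ofReal (2 * r * d) := by
        rw [lintegral_indicator measurableSet_Icc, setLIntegral_const, Real.volume_Icc,
          ← ENNReal.ofReal_mul hd]
        congr 1; ring

/-- A reflection carries b - a to a horizontal vector of the same length and preserves area. -/
theorem volume_closedBall_diff_le (a b : Plane) {r : ℝ} (hr : 0 ≤ r) :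
    volume (Metric.closedBall b r \ Metric.closedBall a r) ≤ ENNReal.ofReal (2 * r * dist a b) := by
  set v : Plane := b - a
  set w : Plane := EuclideanSpace.single 0 (dist a b)
  have hvw : ‖v‖ = ‖w‖ := by simp [v, w, dist_eq_norm']
  set φ : Plane ≃ₗᵢ[ℝ] Plane := (ℝ ∙ (v - w))ᗮ.reflection
  have hφ : φ v = w := Submodule.reflection_sub hvw
  have hb : φ b = φ a + w := by rw [← hφ, ← map_add]; simp [v]
  have himg : φ ⁻¹' (Metric.closedBall (φ a + w) r \ Metric.closedBall (φ a) r) =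
      Metric.closedBall b r \ Metric.closedBall a r := by
    rw [← hb]
    ext x
    simp
  rw [← himg, φ.measurePreserving.measure_preimage
    (Metric.isClosed_closedBall.measurableSet.diff
      Metric.isClosed_closedBall.measurableSet).nullMeasurableSet]
  exact volume_closedBall_diff_le_of_horizontal _ dist_nonneg hr

/-- The area of the `r`-neighbourhood of the vertices of a polygonal path. -/
theorem volume_iUnion_closedBall_le (q : ℕ → Plane) {r : ℝ} (hr : 0 ≤ r) (m : ℕ) :
    volume (⋃ i ∈ Finset.range (m + 1), Metric.closedBall (q i) r) ≤
      ENNReal.ofReal (π * r ^ 2 + 2 * r * ∑ i ∈ Finset.range m, dist (q i) (q (i + 1))) := by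
  induction m with
  | zero =>
    simp only [zero_add, Finset.range_one, Finset.mem_singleton, Set.iUnion_iUnion_eq_left,
      Finset.range_zero, Finset.sum_empty, mul_zero, add_zero]
    rw [EuclideanSpace.volume_closedBall_fin_two, mul_comm, ENNReal.ofReal_mul Real.pi_pos.le,
      ENNReal.ofReal_pow hr]
  | succ m ih =>
    have hsub : (⋃ i ∈ Finset.range (m + 1 + 1), Metric.closedBall (q i) r) ⊆
        (⋃ i ∈ Finset.range (m + 1), Metric.closedBall (q i) r) ∪
          (Metric.closedBall (q (m + 1)) r \ Metric.closedBall (q m) r) := by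
      intro x hx
      simp only [Set.mem_iUnion, Finset.mem_range, exists_prop] at hx
      obtain ⟨i, hi, hx⟩ := hx
      by_cases hxm : x ∈ Metric.closedBall (q m) r
      · left
        simp only [Set.mem_iUnion, Finset.mem_range, exists_prop]
        exact ⟨m, by omega, hxm⟩
      rcases Nat.lt_succ_iff_lt_or_eq.1 hi with h | rfl
      · left
        simp only [Set.mem_iUnion, Finset.mem_range, exists_prop]
        exact ⟨i, h, hx⟩
      · exact Or.inr ⟨hx, hxm⟩
    refine (measure_mono hsub).trans ((measure_union_le _ _).trans ?_)
    refine (add_le_add ih (volume_closedBall_diff_le _ _ hr)).trans (le_of_eq ?_)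
    rw [← ENNReal.ofReal_add (by positivity) (by positivity), Finset.sum_range_succ]
    congr 1; ring

/-- Disjoint unit disks touched by a polygonal path: area bound. -/
theorem pi_mul_card_le (O q : ℕ → Plane) (m : ℕ)
    (hO : ∀ i ≤ m, ∀ j ≤ m, i ≠ j → 2 < dist (O i) (O j)) (hq : ∀ i ≤ m, dist (q i) (O i) ≤ 1) :
    π * (m + 1) ≤ 4 * π + 4 * ∑ i ∈ Finset.range m, dist (q i) (q (i + 1)) := by
  have hdisj : Set.PairwiseDisjoint (↑(Finset.range (m + 1)))
      fun i => Metric.closedBall (O i) 1 := by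
    intro i hi j hj hij
    simp only [Finset.coe_range, Set.mem_Iio] at hi hj
    apply Metric.closedBall_disjoint_closedBall
    have := hO i (by omega) j (by omega) hij
    linarith
  have h1 : volume (⋃ i ∈ Finset.range (m + 1), Metric.closedBall (O i) 1) =
      ENNReal.ofReal (π * (m + 1)) := by
    rw [measure_biUnion_finset hdisj fun i _ => Metric.isClosed_closedBall.measurableSet]
    simp only [EuclideanSpace.volume_closedBall_fin_two, ENNReal.ofReal_one, one_pow, one_mul,
      Finset.sum_const, Finset.card_range, nsmul_eq_mul]
    rw [mul_comm, ENNReal.ofReal_mul Real.pi_pos.le]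
    congr 1
    rw [← ENNReal.ofReal_natCast]
    push_cast
    rfl
  have h2 : (⋃ i ∈ Finset.range (m + 1), Metric.closedBall (O i) 1) ⊆
      ⋃ i ∈ Finset.range (m + 1), Metric.closedBall (q i) 2 := by
    refine Set.iUnion₂_mono fun i hi => ?_
    simp only [Finset.mem_range] at hi
    apply Metric.closedBall_subset_closedBall'
    have := hq i (by omega)
    rw [dist_comm]
    linarith
  have h3 := (measure_mono h2).trans (volume_iUnion_closedBall_le q (r := 2) (by norm_num) m)
  rw [h1, ENNReal.ofReal_le_ofReal_iff (by positivity)] at h3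
  linarith

end Area

/-! ### Edge sums of closed polygons and local modifications. -/

section Cycles

theorem val_finRotate {n : ℕ} (i : Fin n) :
    (finRotate n i : ℕ) = if (i : ℕ) + 1 = n then 0 else (i : ℕ) + 1 := by
  obtain _ | m := n
  · exact i.elim0
  · rw [coe_finRotate]
    simp [Fin.ext_iff]

theorem finRotate_ne {n : ℕ} (hn : 2 ≤ n) (i : Fin n) : finRotate n i ≠ i := by
  rw [Ne, Fin.ext_iff, val_finRotate]
  split_ifs <;> omega

theorem finRotate_finRotate_ne {n : ℕ} (hn : 3 ≤ n) (i : Fin n) :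
    finRotate n (finRotate n i) ≠ i := by
  rw [Ne, Fin.ext_iff, val_finRotate, val_finRotate]
  have := i.2
  split_ifs <;> omega

theorem sum_finRotate {n : ℕ} (f : Fin n → ℝ) : ∑ i, f (finRotate n i) = ∑ i, f i :=
  Equiv.sum_comp (finRotate n) f

theorem cycleLength_nonneg {n : ℕ} (p : Fin n → Plane) : 0 ≤ cycleLength p :=
  Finset.sum_nonneg fun _ _ => dist_nonneg

theorem cycleLength_smul {n : ℕ} (p : Fin n → Plane) {c : ℝ} (hc : 0 ≤ c) :
    cycleLength (fun i => c • p i) = c * cycleLength p := by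
  simp only [cycleLength, dist_smul₀, Real.norm_of_nonneg hc, Finset.mul_sum]

theorem cycleLength_eq_sum_range {m : ℕ} (p : Fin (m + 1) → Plane) (q : ℕ → Plane)
    (hq : ∀ i : Fin (m + 1), q i = p i) :
    cycleLength p = ∑ i ∈ Finset.range m, dist (q i) (q (i + 1)) + dist (q m) (q 0) := by
  rw [cycleLength, Fin.sum_univ_castSucc, Finset.sum_range]
  congr 1
  · refine Finset.sum_congr rfl fun i _ => ?_
    rw [← hq, ← hq, val_finRotate]
    have := i.2
    simp [this.ne]
  · rw [← hq, ← hq, val_finRotate]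
    simp

/-- Bounding a cycle by a potential that increases along it. -/
theorem cycleLength_le_of_potential {n : ℕ} (p : Fin n → Plane) (G : Fin n → ℝ) {C : ℝ}
    (hC : 0 ≤ C) (hG : ∀ s t, s < t → dist (p s) (p t) ≤ G t - G s)
    (hclose : ∀ s t, s ≤ t → dist (p t) (p s) ≤ C - (G t - G s)) : cycleLength p ≤ C := by
  obtain _ | m := n
  · simpa [cycleLength] using hC
  rw [cycleLength, Fin.sum_univ_castSucc, finRotate_last]
  have h1 : ∀ i : Fin m, dist (p i.castSucc) (p (finRotate (m + 1) i.castSucc)) ≤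
      G i.succ - G i.castSucc := by
    intro i
    have : finRotate (m + 1) i.castSucc = i.succ := by
      rw [Fin.ext_iff, val_finRotate]
      have := i.2
      simp [this.ne]
    rw [this]
    exact hG _ _ i.castSucc_lt_succ
  have h2 : ∑ i : Fin m, (G i.succ - G i.castSucc) = G (Fin.last m) - G 0 := by
    rw [Finset.sum_sub_distrib]
    have := (Fin.sum_univ_succ G).symm.trans (Fin.sum_univ_castSucc G)
    linarith
  have h3 := Finset.sum_le_sum fun i (_ : i ∈ Finset.univ) => h1 i
  have h4 := hclose 0 (Fin.last m) (Fin.zero_le _)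
  linarith

/-- Cycles differing at no edges outside of `S`. -/
theorem sum_edges_le_of_cycleLength_le {n : ℕ} {p p' : Fin n → Plane} (S : Finset (Fin n))
    (h : cycleLength p ≤ cycleLength p')
    (hS : ∀ i ∉ S, p' i = p i ∧ p' (finRotate n i) = p (finRotate n i)) :
    ∑ i ∈ S, dist (p i) (p (finRotate n i)) ≤ ∑ i ∈ S, dist (p' i) (p' (finRotate n i)) := by
  rw [cycleLength, cycleLength, ← Finset.sum_add_sum_compl S, ← Finset.sum_add_sum_compl S] at h
  have : ∑ i ∈ Sᶜ, dist (p i) (p (finRotate n i)) =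
      ∑ i ∈ Sᶜ, dist (p' i) (p' (finRotate n i)) := by
    refine Finset.sum_congr rfl fun i hi => ?_
    obtain ⟨h1, h2⟩ := hS i (Finset.mem_compl.1 hi)
    rw [h1, h2]
  linarith

theorem dist_add_dist_le_of_update {n : ℕ} (hn : 3 ≤ n) {p : Fin n → Plane} (z : Fin n) (y : Plane)
    (h : cycleLength p ≤ cycleLength (Function.update p (finRotate n z) y)) :
    dist (p z) (p (finRotate n z)) + dist (p (finRotate n z)) (p (finRotate n (finRotate n z))) ≤
      dist (p z) y + dist y (p (finRotate n (finRotate n z))) := by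
  have hza := finRotate_ne (by omega) z
  have hab := finRotate_ne (by omega) (finRotate n z)
  have := sum_edges_le_of_cycleLength_le {z, finRotate n z} h (fun i hi => by
    simp only [Finset.mem_insert, Finset.mem_singleton, not_or] at hi
    refine ⟨Function.update_of_ne hi.2 _ _, Function.update_of_ne ?_ _ _⟩
    exact fun h => hi.1 ((finRotate n).injective h))
  rw [Finset.sum_pair hza.symm, Finset.sum_pair hza.symm] at this
  rw [Function.update_self, Function.update_of_ne hza.symm, Function.update_of_ne hab] at this
  exact this

/-- Exchanging consecutive vertices leaves the length of the edge between them unchanged, so only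
its two neighbouring edges enter the comparison. -/
theorem dist_add_dist_le_of_swap {n : ℕ} (hn : 3 ≤ n) {p : Fin n → Plane} (z a b c : Fin n)
    (hza : finRotate n z = a) (hab : finRotate n a = b) (hbc : finRotate n b = c)
    (h : cycleLength p ≤ cycleLength (fun i => p (Equiv.swap a b i))) :
    dist (p z) (p a) + dist (p b) (p c) ≤ dist (p z) (p b) + dist (p a) (p c) := by
  have n1 : a ≠ z := hza ▸ finRotate_ne (by omega) z
  have n2 : b ≠ a := hab ▸ finRotate_ne (by omega) a
  have n3 : c ≠ b := hbc ▸ finRotate_ne (by omega) b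
  have n4 : b ≠ z := by rw [← hab, ← hza]; exact finRotate_finRotate_ne hn z
  have n5 : c ≠ a := by rw [← hbc, ← hab]; exact finRotate_finRotate_ne hn a
  have := sum_edges_le_of_cycleLength_le {z, a, b} h (fun i hi => by
    simp only [Finset.mem_insert, Finset.mem_singleton, not_or] at hi
    have h1 : finRotate n i ≠ a := fun h => hi.1 ((finRotate n).injective (h.trans hza.symm))
    have h2 : finRotate n i ≠ b := fun h => hi.2.1 ((finRotate n).injective (h.trans hab.symm))
    simp only [Equiv.swap_apply_of_ne_of_ne hi.2.1 hi.2.2, Equiv.swap_apply_of_ne_of_ne h1 h2,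
      and_self])
  rw [Finset.sum_insert (by simp [n1.symm, n4.symm]), Finset.sum_pair n2.symm,
    Finset.sum_insert (by simp [n1.symm, n4.symm]), Finset.sum_pair n2.symm, hza, hab, hbc,
    Equiv.swap_apply_left, Equiv.swap_apply_right, Equiv.swap_apply_of_ne_of_ne n1.symm n4.symm,
    Equiv.swap_apply_of_ne_of_ne n5 n3, dist_comm (p b) (p a)] at this
  linarith

end Cycles

/-! ### Comparison of tour and centers for unit disks. -/

section UnitDisks

variable {n : ℕ} {O P : Fin n → Plane}

theorem dist_center_le (hP : ∀ i, dist (P i) (O i) ≤ 1) (i j : Fin n) :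
    dist (O i) (O j) ≤ 2 + dist (P i) (P j) := by
  have h1 := dist_triangle (O i) (P i) (O j)
  have h2 := dist_triangle (P i) (P j) (O j)
  have h3 := hP i
  have h4 := hP j
  rw [dist_comm] at h3
  linarith

theorem cycleLength_center_le (hP : ∀ i, dist (P i) (O i) ≤ 1) :
    cycleLength O ≤ cycleLength P + 2 * n := by
  have := Finset.sum_le_sum fun i (_ : i ∈ Finset.univ) => dist_center_le hP i (finRotate n i)
  rw [Finset.sum_add_distrib] at this
  simp only [Finset.sum_const, Finset.card_univ, Fintype.card_fin, nsmul_eq_mul] at this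
  unfold cycleLength
  linarith

theorem dist_touching_center_le (hP : ∀ i, dist (P i) (O i) ≤ 1) (i j : Fin n) :
    ‖O i - P j‖ ≤ 1 + dist (P i) (P j) := by
  have h := dist_triangle_left (O i) (P j) (P i)
  have := hP i
  rw [dist_eq_norm (O i)] at h
  linarith

/-- Sum of `pair_loss_ge` over all vertices; every edge is counted twice. Only disjointness is
needed, not optimality. -/
theorem cycleLength_center_le_of_disjoint (hn : 3 ≤ n) (hP : ∀ i, dist (P i) (O i) ≤ 1)
    (hO : ∀ i j, i ≠ j → 2 < dist (O i) (O j)) :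
    cycleLength O ≤ 1.1 * cycleLength P + 1.9 * n := by
  have key : ∀ i : Fin n, dist (O i) (O (finRotate n i)) +
      dist (O (finRotate n i)) (O (finRotate n (finRotate n i))) ≤
      1.1 * (dist (P i) (P (finRotate n i)) +
      dist (P (finRotate n i)) (P (finRotate n (finRotate n i)))) + 3.8 := by
    intro i
    set j := finRotate n i
    set k := finRotate n j
    have h := pair_loss_ge (w := P j - O j) (u := O i - P j) (v := O k - P j)
      (e := dist (P i) (P j)) (f := dist (P j) (P k)) dist_nonneg dist_nonneg
      (by rw [← dist_eq_norm]; exact hP j) (dist_touching_center_le hP i j)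
      (by rw [dist_comm]; exact dist_touching_center_le hP k j)
      (by
        rw [sub_sub_sub_cancel_right, ← dist_eq_norm]
        exact (hO i k (finRotate_finRotate_ne hn i).symm).le)
    rw [add_comm (P j - O j), sub_add_sub_cancel, add_comm (P j - O j), sub_add_sub_cancel,
      ← dist_eq_norm, ← dist_eq_norm, dist_comm (O k)] at h
    linarith
  have := Finset.sum_le_sum fun i (_ : i ∈ Finset.univ) => key i
  rw [Finset.sum_add_distrib, Finset.sum_add_distrib, ← Finset.mul_sum, Finset.sum_add_distrib,
    sum_finRotate fun i => dist (O i) (O (finRotate n i)),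
    sum_finRotate fun i => dist (P i) (P (finRotate n i))] at this
  simp only [Finset.sum_const, Finset.card_univ, Fintype.card_fin, nsmul_eq_mul] at this
  unfold cycleLength
  linarith

theorem pi_mul_card_le_cycleLength (hP : ∀ i, dist (P i) (O i) ≤ 1)
    (hO : ∀ i j, i ≠ j → 2 < dist (O i) (O j)) : π * n ≤ 4 * π + 4 * cycleLength P := by
  obtain _ | m := n
  · have := cycleLength_nonneg P
    have := Real.pi_pos
    simp only [Nat.cast_zero, mul_zero]
    positivity
  have hof : ∀ i : Fin (m + 1), Fin.ofNat (m + 1) i = i := fun i => by simp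
  have h := pi_mul_card_le (fun i => O (Fin.ofNat (m + 1) i)) (fun i => P (Fin.ofNat (m + 1) i)) m
    (by
      intro i hi j hj hij
      apply hO
      rw [Ne, Fin.ext_iff, Fin.val_ofNat, Fin.val_ofNat, Nat.mod_eq_of_lt (by omega),
        Nat.mod_eq_of_lt (by omega)]
      exact hij) (fun i _ => hP _)
  rw [cycleLength_eq_sum_range P (fun i => P (Fin.ofNat (m + 1) i)) (by intro i; simp)]
  have := dist_nonneg (x := P (Fin.ofNat (m + 1) m)) (y := P (Fin.ofNat (m + 1) 0))
  push_cast
  linarith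

theorem cycleLength_center_le_mul (hP : ∀ i, dist (P i) (O i) ≤ 1)
    (hO : ∀ i j, i ≠ j → 2 < dist (O i) (O j)) :
    cycleLength O ≤ 3.53 * cycleLength P + 8 := by
  have hL := cycleLength_nonneg P
  rcases le_or_gt n 4 with hn | hn
  · have h1 := cycleLength_center_le hP
    have h2 : (n : ℝ) ≤ 4 := by exact_mod_cast hn
    linarith
  · have h1 := cycleLength_center_le_of_disjoint (by omega) hP hO
    have h2 := pi_mul_card_le_cycleLength hP hO
    have h3 := Real.pi_gt_d2
    -- 1.274 exceeds 4 / 3.14 > 4 / π, and 1.1 + 1.9 · 1.274 < 3.53.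
    have h4 : (n : ℝ) ≤ 4 + 1.274 * cycleLength P := by
      have h5 : π * n ≤ π * (4 + 1.274 * cycleLength P) := by nlinarith
      exact le_of_mul_le_mul_left h5 Real.pi_pos
    linarith

theorem one_lt_dist_of_disjoint (hP : ∀ i, dist (P i) (O i) ≤ 1)
    (hO : ∀ i j, i ≠ j → 2 < dist (O i) (O j)) {i j : Fin n} (hij : i ≠ j) :
    1 < dist (P i) (O j) := by
  have h1 := dist_triangle_left (O i) (O j) (P i)
  have h2 := hP i
  have h3 := hO i j hij
  linarith

/-- If the lengths differ by at most 1.5, either alternative of `h3` bounds both of them by 3, and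
`lt_abs_sub_of_pair_loss_lt` applies. -/
theorem lt_abs_sub_or_loss (hn : 3 ≤ n) (hP : ∀ i, dist (P i) (O i) ≤ 1)
    (hO : ∀ i j, i ≠ j → 2 < dist (O i) (O j))
    {i j k : Fin n} (hij : finRotate n i = j) (hjk : finRotate n j = k)
    (h3 : min (dist (P i) (P j)) (dist (P j) (P k)) ≤ 1.5 ∨
      max (dist (P i) (P j)) (dist (P j) (P k)) ≤ 3) :
    0.015 ≤ 4 + dist (P i) (P j) + dist (P j) (P k) - dist (O i) (O j) - dist (O j) (O k) ∨
      1.5 < |dist (P i) (P j) - dist (P j) (P k)| := by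
  by_contra! hcon
  obtain ⟨h1, h2⟩ := hcon
  have hik : i ≠ k := by rw [← hjk, ← hij]; exact (finRotate_finRotate_ne hn i).symm
  obtain ⟨h4, h5⟩ := abs_le.1 h2
  have hb : dist (P i) (P j) ≤ 3 ∧ dist (P j) (P k) ≤ 3 := by
    rcases h3 with h | h
    · rcases min_le_iff.1 h with h | h <;> constructor <;> linarith
    · exact max_le_iff.1 h
  have h := lt_abs_sub_of_pair_loss_lt (w := P j - O j) (u := O i - P j) (v := O k - P j)
      (e := dist (P i) (P j)) (f := dist (P j) (P k)) dist_nonneg dist_nonneg hb.1 hb.2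
      (by rw [← dist_eq_norm]; exact hP j) (dist_touching_center_le hP i j)
      (by rw [dist_comm]; exact dist_touching_center_le hP k j)
      (by
        rw [sub_sub_sub_cancel_right, ← dist_eq_norm]
        exact (hO i k hik).le)
      (by
        rw [add_comm (P j - O j), sub_add_sub_cancel, add_comm (P j - O j), sub_add_sub_cancel,
          ← dist_eq_norm, ← dist_eq_norm, dist_comm (O k)]
        linarith)
  linarith

/-- At a vertex of a locally optimal tour with an angle of at least `60°`, some length is lost. -/
theorem loss_of_wide_angle (hn : 3 ≤ n) (hP : ∀ i, dist (P i) (O i) ≤ 1)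
    (hO : ∀ i j, i ≠ j → 2 < dist (O i) (O j))
    (hmove : ∀ i y, dist y (O i) ≤ 1 → cycleLength P ≤ cycleLength (Function.update P i y))
    {i j k : Fin n} (hij : finRotate n i = j) (hjk : finRotate n j = k)
    (hangle : inner ℝ (‖P i - P j‖⁻¹ • (P i - P j)) (‖P k - P j‖⁻¹ • (P k - P j)) ≤ (1 / 2 : ℝ)) :
    0.015 ≤ 4 + dist (P i) (P j) + dist (P j) (P k) - dist (O i) (O j) - dist (O j) (O k) := by
  -- Two edges shorter than 0.2 cannot differ by 1.5, so disjointness alone forces the loss.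
  rcases lt_or_ge (max (dist (P i) (P j)) (dist (P j) (P k))) 0.2 with hshort | hlong
  · refine (lt_abs_sub_or_loss hn hP hO hij hjk (Or.inr (by linarith))).resolve_right fun h => ?_
    have h1 := max_lt_iff.1 hshort
    have h2 := dist_nonneg (x := P i) (y := P j)
    have h3 := dist_nonneg (x := P j) (y := P k)
    rcases lt_abs.1 h with h | h <;> linarith
  have nij : i ≠ j := hij ▸ (finRotate_ne (by omega) i).symm
  have njk : k ≠ j := hjk ▸ finRotate_ne (by omega) j
  have hne : ∀ {a b}, a ≠ b → P a ≠ P b := fun {a b} hab h => by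
    have h1 := one_lt_dist_of_disjoint hP hO hab
    have h2 := hP b
    rw [h] at h1
    linarith
  have hi : ‖P i - P j‖ ≠ 0 := norm_ne_zero_iff.2 (sub_ne_zero.2 (hne nij))
  have hk : ‖P k - P j‖ ≠ 0 := norm_ne_zero_iff.2 (sub_ne_zero.2 (hne njk))
  set a := ‖P i - P j‖⁻¹ • (P i - P j) with ha
  set b := ‖P k - P j‖⁻¹ • (P k - P j) with hb
  have ha1 : ‖a‖ = 1 := by rw [ha, norm_smul, norm_inv, norm_norm, inv_mul_cancel₀ hi]
  have hb1 : ‖b‖ = 1 := by rw [hb, norm_smul, norm_inv, norm_norm, inv_mul_cancel₀ hk]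
  have hea : P j - O j + dist (P i) (P j) • a = P i - O j := by
    rw [ha, dist_eq_norm, smul_smul, mul_inv_cancel₀ hi, one_smul]; abel
  have hfb : P j - O j + dist (P j) (P k) • b = P k - O j := by
    rw [hb, dist_comm, dist_eq_norm, smul_smul, mul_inv_cancel₀ hk, one_smul]; abel
  have hw : ‖P j - O j‖ ≤ 1 := by rw [← dist_eq_norm]; exact hP j
  have key := wide_vertex_loss (w := P j - O j) (e := dist (P i) (P j)) (f := dist (P j) (P k))
    hw ha1 hb1
    (dist_pos.2 (hne nij)) (dist_pos.2 (hne njk.symm)) hangle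
    (norm_le_inner_of_forall_inner_le fun y hy => by
      have := inner_le_zero_of_forall_dist_add_le (x := P j) (A := P i) (B := P k) (y := y + O j)
        (hne nij) (hne njk) (fun t ht ht1 => by
          have hd := dist_add_dist_le_of_update hn i (P j + t • (y + O j - P j)) (by
            apply hmove
            rw [hij]
            have h1 : P j + t • (y + O j - P j) - O j = (1 - t) • (P j - O j) + t • y := by
              module
            rw [dist_eq_norm, h1]
            refine (norm_add_le _ _).trans ?_
            rw [norm_smul, norm_smul, Real.norm_of_nonneg ht.le,
              Real.norm_of_nonneg (sub_nonneg.2 ht1)]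
            nlinarith)
          rw [hij, hjk] at hd
          exact hd)
      convert this using 2
      abel)
    (by rw [hea, ← dist_eq_norm]; exact (one_lt_dist_of_disjoint hP hO nij).le)
    (by rw [hfb, ← dist_eq_norm]; exact (one_lt_dist_of_disjoint hP hO njk).le) hlong
  rw [hea, hfb, ← dist_eq_norm, ← dist_eq_norm] at key
  have t1 := dist_triangle_left (O i) (O j) (P i)
  have t2 := dist_triangle_left (O k) (O j) (P k)
  have := hP i
  have := hP k
  rw [dist_comm (O k)] at t2
  linarith

end UnitDisks

/-! ### Losses along a locally optimal tour. -/

section UnitDisks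

variable {n : ℕ} {O P : Fin n → Plane}

theorem ne_of_disjoint (hP : ∀ i, dist (P i) (O i) ≤ 1)
    (hO : ∀ i j, i ≠ j → 2 < dist (O i) (O j)) {i j : Fin n} (hij : i ≠ j) : P i ≠ P j := by
  intro h
  have h1 := one_lt_dist_of_disjoint hP hO hij
  have h2 := hP j
  rw [h] at h1
  linarith

theorem dist_lt_of_narrow {x y z : Plane} (hx : x ≠ y) (hz : z ≠ y) (hle : dist z y ≤ dist x y)
    (hangle : (1 / 2 : ℝ) < inner ℝ (‖x - y‖⁻¹ • (x - y)) (‖z - y‖⁻¹ • (z - y))) :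
    dist x z < dist x y := by
  have hx' : ‖x - y‖ ≠ 0 := norm_ne_zero_iff.2 (sub_ne_zero.2 hx)
  have hz' : ‖z - y‖ ≠ 0 := norm_ne_zero_iff.2 (sub_ne_zero.2 hz)
  have := norm_sub_lt_of_narrow (x := x - y) (y := z - y) (e := ‖x - y‖) (f := ‖z - y‖)
    (by rw [smul_smul, mul_inv_cancel₀ hx', one_smul])
    (by rw [smul_smul, mul_inv_cancel₀ hz', one_smul])
    (by rw [norm_smul, norm_inv, norm_norm, inv_mul_cancel₀ hx'])
    (by rw [norm_smul, norm_inv, norm_norm, inv_mul_cancel₀ hz'])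
    (norm_pos_iff.2 (sub_ne_zero.2 hx)) (norm_pos_iff.2 (sub_ne_zero.2 hz))
    (by rwa [← dist_eq_norm, ← dist_eq_norm]) hangle
  rwa [sub_sub_sub_cancel_right, ← dist_eq_norm, ← dist_eq_norm] at this

/-- Next to a locally shortest edge of a locally optimal tour, some length is lost. -/
theorem loss_of_local_min (hn : 3 ≤ n) (hP : ∀ i, dist (P i) (O i) ≤ 1)
    (hO : ∀ i j, i ≠ j → 2 < dist (O i) (O j))
    (hmove : ∀ i y, dist y (O i) ≤ 1 → cycleLength P ≤ cycleLength (Function.update P i y))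
    (hswap : ∀ i j, cycleLength P ≤ cycleLength (fun s => P (Equiv.swap i j s)))
    {z a b c : Fin n} (hza : finRotate n z = a) (hab : finRotate n a = b)
    (hbc : finRotate n b = c)
    (h1 : dist (P a) (P b) ≤ dist (P z) (P a)) (h2 : dist (P a) (P b) ≤ dist (P b) (P c)) :
    0.015 ≤ 4 + dist (P z) (P a) + dist (P a) (P b) - dist (O z) (O a) - dist (O a) (O b) ∨
    0.015 ≤ 4 + dist (P a) (P b) + dist (P b) (P c) - dist (O a) (O b) - dist (O b) (O c) := by
  have nza : z ≠ a := hza ▸ (finRotate_ne (by omega) z).symm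
  have nab : a ≠ b := hab ▸ (finRotate_ne (by omega) a).symm
  have nbc : b ≠ c := hbc ▸ (finRotate_ne (by omega) b).symm
  -- Without loss both angles are below 60°. Then zb is shorter than za and ac is shorter than bc,
  -- so exchanging a and b shortens the tour.
  by_contra! hcon
  have ha : ¬ _ := fun h => hcon.1.not_ge (loss_of_wide_angle hn hP hO hmove hza hab h)
  have hb : ¬ _ := fun h => hcon.2.not_ge (loss_of_wide_angle hn hP hO hmove hab hbc h)
  have h3 := dist_lt_of_narrow (ne_of_disjoint hP hO nza) (ne_of_disjoint hP hO nab.symm)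
    (by rwa [dist_comm (P b)]) (not_le.1 ha)
  have h4 := dist_lt_of_narrow (ne_of_disjoint hP hO nbc.symm) (ne_of_disjoint hP hO nab)
    (by rwa [dist_comm (P c)]) (by rw [real_inner_comm]; exact not_le.1 hb)
  have h5 := dist_add_dist_le_of_swap hn z a b c hza hab hbc (hswap a b)
  rw [dist_comm (P c) (P a), dist_comm (P c) (P b)] at h4
  linarith

/-- Length lost near an edge `b c` of length less than `3`. -/
theorem loss_near_short_edge (hn : 3 ≤ n) (hP : ∀ i, dist (P i) (O i) ≤ 1)
    (hO : ∀ i j, i ≠ j → 2 < dist (O i) (O j))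
    (hmove : ∀ i y, dist y (O i) ≤ 1 → cycleLength P ≤ cycleLength (Function.update P i y))
    (hswap : ∀ i j, cycleLength P ≤ cycleLength (fun s => P (Equiv.swap i j s)))
    (l : Fin n → ℝ) (hl : ∀ i, l i = 2 + dist (P i) (P (finRotate n i)) -
      dist (O i) (O (finRotate n i)))
    {z a b c d : Fin n} (hza : finRotate n z = a) (hab : finRotate n a = b)
    (hbc : finRotate n b = c) (hcd : finRotate n c = d)
    (h3 : dist (P b) (P c) < 3) : 0.015 ≤ l z + l a + l b + l c + l d := by
  have hl0 : ∀ i, 0 ≤ l i := fun i => by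
    have := dist_center_le hP i (finRotate n i)
    rw [hl]; linarith
  have := hl0 z
  have := hl0 a
  have := hl0 b
  have := hl0 c
  have := hl0 d
  obtain ⟨e, hde⟩ : ∃ e, finRotate n d = e := ⟨_, rfl⟩
  have lz := hl z
  have la := hl a
  have lb := hl b
  have lc := hl c
  have ld := hl d
  rw [hza] at lz
  rw [hab] at la
  rw [hbc] at lb
  rw [hcd] at lc
  rw [hde] at ld
  have hzp := dist_nonneg (x := P z) (y := P a)
  have hap := dist_nonneg (x := P a) (y := P b)
  have hbp := dist_nonneg (x := P b) (y := P c)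
  have hcp := dist_nonneg (x := P c) (y := P d)
  have hdp := dist_nonneg (x := P d) (y := P e)
  by_contra! hcon
  -- If ab is shorter than bc, the difference above 1.5 makes ab < 1.5. Then za, also differing from
  -- ab by more than 1.5, must be longer, so ab is locally shortest. The case of cd is symmetric;
  -- otherwise bc itself is locally shortest.
  rcases lt_or_ge (dist (P a) (P b)) (dist (P b) (P c)) with hlt | hge
  · rcases lt_abs_sub_or_loss hn hP hO hab hbc (Or.inr (max_le (by linarith) h3.le)) with h | h
    · linarith
    have hsm : dist (P a) (P b) < 1.5 := by rcases lt_abs.1 h with h | h <;> linarith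
    rcases lt_abs_sub_or_loss hn hP hO hza hab (Or.inl ((min_le_right _ _).trans hsm.le)) with h' | h'
    · linarith
    have hlm : dist (P a) (P b) ≤ dist (P z) (P a) := by
      rcases lt_abs.1 h' with h | h <;> linarith
    rcases loss_of_local_min hn hP hO hmove hswap hza hab hbc hlm hlt.le with h | h <;> linarith
  rcases lt_or_ge (dist (P c) (P d)) (dist (P b) (P c)) with hlt | hge'
  · rcases lt_abs_sub_or_loss hn hP hO hbc hcd (Or.inr (max_le h3.le (by linarith))) with h | h
    · linarith
    have hsm : dist (P c) (P d) < 1.5 := by rcases lt_abs.1 h with h | h <;> linarith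
    rcases lt_abs_sub_or_loss hn hP hO hcd hde (Or.inl ((min_le_left _ _).trans hsm.le)) with h' | h'
    · linarith
    have hlm : dist (P c) (P d) ≤ dist (P d) (P e) := by
      rcases lt_abs.1 h' with h | h <;> linarith
    rcases loss_of_local_min hn hP hO hmove hswap hbc hcd hde hlt.le hlm with h | h <;> linarith
  rcases loss_of_local_min hn hP hO hmove hswap hab hbc hcd hge hge' with h | h <;> linarith

theorem cycleLength_center_le_of_optimal (hn : 3 ≤ n) (hP : ∀ i, dist (P i) (O i) ≤ 1)
    (hO : ∀ i j, i ≠ j → 2 < dist (O i) (O j))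
    (hmove : ∀ i y, dist y (O i) ≤ 1 → cycleLength P ≤ cycleLength (Function.update P i y))
    (hswap : ∀ i j, cycleLength P ≤ cycleLength (fun s => P (Equiv.swap i j s))) :
    cycleLength O ≤ cycleLength P + 1.999 * n ∨ cycleLength O ≤ 2 * cycleLength P := by
  set r := finRotate n
  rcases le_or_gt (2 * (n : ℝ)) (cycleLength P) with hL | hL
  · right
    have := cycleLength_center_le hP
    linarith
  left
  set l : Fin n → ℝ := fun i => 2 + dist (P i) (P (r i)) - dist (O i) (O (r i)) with hl
  -- The left side replaces the indicator of a short edge by a linear lower bound. Summing counts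
  -- every loss five times, and L < 2n gives total loss at least 0.015 · (n / 3) / 5 = 0.001 n.
  have key : ∀ i, 0.015 * (1 - dist (P (r (r i))) (P (r (r (r i)))) / 3) ≤
      l i + l (r i) + l (r (r i)) + l (r (r (r i))) + l (r (r (r (r i)))) := by
    intro i
    have hl0 : ∀ i, 0 ≤ l i := fun i => by
      have := dist_center_le hP i (r i)
      simp only [hl]; linarith
    rcases lt_or_ge (dist (P (r (r i))) (P (r (r (r i))))) 3 with h3 | h3
    · have := loss_near_short_edge hn hP hO hmove hswap l (fun i => rfl)
        (z := i) rfl rfl rfl rfl h3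
      have hd := dist_nonneg (x := P (r (r i))) (y := P (r (r (r i))))
      refine le_trans ?_ this
      linarith
    · have := hl0 i
      have := hl0 (r i)
      have := hl0 (r (r i))
      have := hl0 (r (r (r i)))
      have := hl0 (r (r (r (r i))))
      linarith
  have hsum := Finset.sum_le_sum fun i (_ : i ∈ Finset.univ) => key i
  have s1 : ∀ f : Fin n → ℝ, ∑ i, f (r i) = ∑ i, f i := sum_finRotate
  have s2 : ∀ f : Fin n → ℝ, ∑ i, f (r (r i)) = ∑ i, f i :=
    fun f => (s1 fun i => f (r i)).trans (s1 f)
  have s3 : ∀ f : Fin n → ℝ, ∑ i, f (r (r (r i))) = ∑ i, f i :=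
    fun f => (s1 fun i => f (r (r i))).trans (s2 f)
  have s4 : ∀ f : Fin n → ℝ, ∑ i, f (r (r (r (r i)))) = ∑ i, f i :=
    fun f => (s1 fun i => f (r (r (r i)))).trans (s3 f)
  rw [← Finset.mul_sum, Finset.sum_sub_distrib, ← Finset.sum_div,
    s2 fun i => dist (P i) (P (r i)), Finset.sum_add_distrib, Finset.sum_add_distrib,
    Finset.sum_add_distrib, Finset.sum_add_distrib, s1 l, s2 l, s3 l, s4 l] at hsum
  have hls : ∑ i, l i = 2 * n + cycleLength P - cycleLength O := by
    simp only [hl, Finset.sum_sub_distrib, Finset.sum_add_distrib, cycleLength]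
    simp [mul_comm, r]
  rw [hls] at hsum
  simp only [Finset.sum_const, Finset.card_univ, Fintype.card_fin, nsmul_eq_mul, mul_one] at hsum
  change 0.015 * ((n : ℝ) - cycleLength P / 3) ≤ _ at hsum
  linarith

end UnitDisks

/-! ### Scaling to unit disks, and shortcuts. -/

section Tours

variable {ι : Type*} [Fintype ι] {O : ι → Plane} {R : ℝ}

theorem tspOpt_le (O : ι → Plane) (σ : VisitOrder ι) : tspOpt O ≤ tspLength O σ :=
  ciInf_le (Set.finite_range _).bddBelow σ

theorem TSPNTour.length_nonneg (T : TSPNTour O R) : 0 ≤ T.length :=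
  cycleLength_nonneg _

theorem tspnOpt_le (T : TSPNTour O R) : tspnOpt O R ≤ T.length :=
  ciInf_le ⟨0, by rintro _ ⟨T', rfl⟩; exact T'.length_nonneg⟩ T

theorem DisjointDisks.lt_dist {ι : Type*} {O : ι → Plane} (h : DisjointDisks O R) (hR : 0 ≤ R)
    {i j : ι} (hij : i ≠ j) :
    2 * R < dist (O i) (O j) := by
  have := (disjoint_closedBall_closedBall_iff hR hR).1 (h hij)
  linarith

namespace TSPNTour

/-- The centers in the order of the tour, in units of `R`. -/
noncomputable def unitCenter (T : TSPNTour O R) (s : Fin (Fintype.card ι)) : Plane :=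
  R⁻¹ • O (T.order s)

/-- The points of the tour in their order, in units of `R`. -/
noncomputable def unitPoint (T : TSPNTour O R) (s : Fin (Fintype.card ι)) : Plane :=
  R⁻¹ • T.point (T.order s)

theorem cycleLength_unitCenter (T : TSPNTour O R) (hR : 0 < R) :
    cycleLength T.unitCenter = R⁻¹ * tspLength O T.order :=
  cycleLength_smul _ (inv_nonneg.2 hR.le)

theorem cycleLength_unitPoint (T : TSPNTour O R) (hR : 0 < R) :
    cycleLength T.unitPoint = R⁻¹ * T.length :=
  cycleLength_smul _ (inv_nonneg.2 hR.le)

theorem dist_unit_le (T : TSPNTour O R) (hR : 0 < R) (s : Fin (Fintype.card ι)) :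
    dist (T.unitPoint s) (T.unitCenter s) ≤ 1 := by
  rw [unitPoint, unitCenter, dist_smul₀, Real.norm_of_nonneg (inv_nonneg.2 hR.le),
    inv_mul_le_iff₀ hR, mul_one]
  exact T.mem_disk _

theorem lt_dist_unitCenter (T : TSPNTour O R) (hR : 0 < R) (h : DisjointDisks O R)
    (s t : Fin (Fintype.card ι)) (hst : s ≠ t) : 2 < dist (T.unitCenter s) (T.unitCenter t) := by
  rw [unitCenter, unitCenter, dist_smul₀, Real.norm_of_nonneg (inv_nonneg.2 hR.le),
    lt_inv_mul_iff₀ hR, mul_comm]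
  exact h.lt_dist hR.le (T.order.injective.ne hst)

theorem tspOpt_le_of_disjoint (T : TSPNTour O R) (hR : 0 < R) (h : DisjointDisks O R) :
    tspOpt O ≤ 3.53 * T.length + 8 * R := by
  have key := cycleLength_center_le_mul (T.dist_unit_le hR) (T.lt_dist_unitCenter hR h)
  rw [T.cycleLength_unitCenter hR, T.cycleLength_unitPoint hR, inv_mul_le_iff₀ hR] at key
  refine (tspOpt_le O T.order).trans (key.trans (le_of_eq ?_))
  field_simp

theorem pi_mul_card_le_length (T : TSPNTour O R) (hR : 0 < R) (h : DisjointDisks O R) :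
    π * Fintype.card ι * R ≤ 4 * π * R + 4 * T.length := by
  have key := pi_mul_card_le_cycleLength (T.dist_unit_le hR) (T.lt_dist_unitCenter hR h)
  rw [T.cycleLength_unitPoint hR] at key
  calc π * Fintype.card ι * R ≤ (4 * π + 4 * (R⁻¹ * T.length)) * R := by gcongr
    _ = _ := by field_simp

theorem IsOptimal.length_le {T : TSPNTour O R} (hT : T.IsOptimal) (T' : TSPNTour O R) :
    T.length ≤ T'.length :=
  (le_of_eq hT).trans (tspnOpt_le T')

theorem IsOptimal.cycleLength_le_update {T : TSPNTour O R} (hT : T.IsOptimal) (hR : 0 < R)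
    (s : Fin (Fintype.card ι)) (y : Plane) (hy : dist y (T.unitCenter s) ≤ 1) :
    cycleLength T.unitPoint ≤ cycleLength (Function.update T.unitPoint s y) := by
  classical
  have hmem : R • y ∈ Metric.closedBall (O (T.order s)) R := by
    have h1 : O (T.order s) = R • T.unitCenter s := by
      rw [unitCenter, smul_smul, mul_inv_cancel₀ hR.ne', one_smul]
    rw [Metric.mem_closedBall, h1, dist_smul₀, Real.norm_of_nonneg hR.le]
    nlinarith
  let T' : TSPNTour O R :=
    ⟨T.order, Function.update T.point (T.order s) (R • y), fun j => by
      by_cases hj : j = T.order s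
      · subst hj; simpa using hmem
      · rw [Function.update_of_ne hj]; exact T.mem_disk j⟩
  have hT' : T'.unitPoint = Function.update T.unitPoint s y := by
    ext1 t
    by_cases ht : t = s
    · subst ht
      simp [unitPoint, T', smul_smul, inv_mul_cancel₀ hR.ne']
    · simp [unitPoint, T', Function.update_of_ne ht,
        Function.update_of_ne (T.order.injective.ne ht)]
  rw [← hT', T.cycleLength_unitPoint hR, T'.cycleLength_unitPoint hR]
  exact mul_le_mul_of_nonneg_left (hT.length_le T') (inv_nonneg.2 hR.le)

theorem IsOptimal.cycleLength_le_swap {T : TSPNTour O R} (hT : T.IsOptimal) (hR : 0 < R)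
    (s t : Fin (Fintype.card ι)) :
    cycleLength T.unitPoint ≤ cycleLength (fun i => T.unitPoint (Equiv.swap s t i)) := by
  let T' : TSPNTour O R := ⟨(Equiv.swap s t).trans T.order, T.point, T.mem_disk⟩
  have hT' : T'.unitPoint = fun i => T.unitPoint (Equiv.swap s t i) := rfl
  rw [← hT', T.cycleLength_unitPoint hR, T'.cycleLength_unitPoint hR]
  exact mul_le_mul_of_nonneg_left (hT.length_le T') (inv_nonneg.2 hR.le)

theorem IsOptimal.tspOpt_le {T : TSPNTour O R} (hT : T.IsOptimal) (hR : 0 < R)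
    (h : DisjointDisks O R) (hn : 3 ≤ Fintype.card ι) :
    tspOpt O ≤ tspnOpt O R + 1.999 * R * (Fintype.card ι : ℝ) ∨ tspOpt O ≤ 2 * tspnOpt O R := by
  have key := cycleLength_center_le_of_optimal hn (T.dist_unit_le hR) (T.lt_dist_unitCenter hR h)
    (hT.cycleLength_le_update hR) (hT.cycleLength_le_swap hR)
  rw [T.cycleLength_unitCenter hR, T.cycleLength_unitPoint hR, inv_mul_le_iff₀ hR,
    inv_mul_le_iff₀ hR] at key
  rw [← show T.length = tspnOpt O R from hT]
  refine key.imp (fun h => ?_) fun h => ?_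
  · refine (_root_.tspOpt_le O T.order).trans (h.trans (le_of_eq ?_))
    field_simp
  · refine (_root_.tspOpt_le O T.order).trans (h.trans (le_of_eq ?_))
    field_simp

end TSPNTour

/-- A finite family can be visited in the order given by a key. -/
theorem exists_visitOrder_monotone {κ : Type*} [LinearOrder κ] (f : ι → κ) :
    ∃ σ : VisitOrder ι, Monotone (f ∘ σ) := by
  let e := (Fintype.equivFin ι).symm
  exact ⟨(Tuple.sort (f ∘ e)).trans e, Tuple.monotone_sort (f ∘ e)⟩

/-- Shortcutting: skipping vertices cannot lengthen a closed polygon, by the triangle inequality,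
and a monotone map may also repeat vertices. -/
theorem cycleLength_comp_le {n k : ℕ} (p : Fin n → Plane) {φ : Fin k → Fin n} (hφ : Monotone φ) :
    cycleLength (p ∘ φ) ≤ cycleLength p := by
  obtain _ | m := n
  · obtain _ | k := k
    · simp [cycleLength]
    · exact (φ 0).elim0
  set q : ℕ → Plane := fun i => p (Fin.ofNat (m + 1) i)
  have hq : ∀ i : Fin (m + 1), q i = p i := fun i => by simp [q]
  have hC := cycleLength_eq_sum_range p q hq
  set F : ℕ → ℝ := fun c => ∑ i ∈ Finset.range c, dist (q i) (q (i + 1)) with hF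
  have hdist : ∀ a b, a ≤ b → dist (q a) (q b) ≤ F b - F a := fun a b hab => by
    refine (dist_le_Ico_sum_dist q hab).trans (le_of_eq ?_)
    rw [Finset.sum_Ico_eq_sub _ hab]
  refine cycleLength_le_of_potential _ (fun t => F (φ t)) (cycleLength_nonneg p)
    (fun s t hst => ?_) fun s t hst => ?_
  · simp only [Function.comp_apply, ← hq]
    exact hdist _ _ (Fin.le_def.1 (hφ hst.le))
  · simp only [Function.comp_apply, ← hq]
    have h1 := hdist (φ t) m (by have := (φ t).2; omega)
    have h2 := hdist 0 (φ s) (Nat.zero_le _)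
    have h3 := dist_triangle4 (q (φ t)) (q m) (q 0) (q (φ s))
    have h4 : F 0 = 0 := by simp [hF]
    have h5 : F m = ∑ i ∈ Finset.range m, dist (q i) (q (i + 1)) := rfl
    linarith

theorem tspnOpt_subfamily_le (I : Finset ι) (hR : 0 ≤ R) :
    tspnOpt (fun i : I => O i) R ≤ tspnOpt O R := by
  obtain ⟨T, hT⟩ := TSPNTour.exists_isOptimal O hR
  obtain ⟨σ, hσ⟩ := exists_visitOrder_monotone fun i : I => T.order.symm i
  let T' : TSPNTour (fun i : I => O i) R := ⟨σ, fun i => T.point i, fun i => T.mem_disk i⟩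
  refine (tspnOpt_le T').trans ((le_of_eq ?_).trans
    ((cycleLength_comp_le (fun s => T.point (T.order s)) hσ).trans hT.le))
  simp [TSPNTour.length, T', Function.comp_def]

end Tours

/-! ### Greedy selection of disjoint disks. -/

section Greedy

variable {ι : Type*} {O : ι → Plane} {R : ℝ} {S I : Finset ι}

theorem GreedyDisjoint.subset (h : GreedyDisjoint O R S I) : I ⊆ S := by
  classical
  induction h with
  | nil => exact Finset.Subset.refl _
  | select S I i mem _ _ ih =>
    intro j hj
    rcases Finset.mem_insert.1 hj with rfl | hj
    · exact mem
    · exact (Finset.mem_filter.1 (ih hj)).1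

theorem GreedyDisjoint.disjoint (h : GreedyDisjoint O R S I) {i j : ι} (hi : i ∈ I) (hj : j ∈ I)
    (hij : i ≠ j) : Disjoint (Metric.closedBall (O i) R) (Metric.closedBall (O j) R) := by
  classical
  induction h with
  | nil => simp at hi
  | select S I a mem _ rest ih =>
    rcases Finset.mem_insert.1 hi with rfl | hi'
    · rcases Finset.mem_insert.1 hj with rfl | hj'
      · exact absurd rfl hij
      · exact (Finset.mem_filter.1 (rest.subset hj')).2
    · rcases Finset.mem_insert.1 hj with rfl | hj'
      · exact (Finset.mem_filter.1 (rest.subset hi')).2.symm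
      · exact ih hi' hj'

theorem GreedyDisjoint.disjointDisks (h : GreedyDisjoint O R S I) :
    DisjointDisks (fun i : I => O i) R :=
  fun i j hij => h.disjoint i.2 j.2 fun h => hij (Subtype.ext h)

/-- Every disk is selected or deleted at some stage; the disk selected at that stage meets it and
was leftmost while it was still present. -/
theorem GreedyDisjoint.exists_near (h : GreedyDisjoint O R S I) (hR : 0 ≤ R) {j : ι} (hj : j ∈ S) :
    ∃ i ∈ I, O i 0 ≤ O j 0 ∧ dist (O i) (O j) ≤ 2 * R := by
  classical
  induction h with
  | nil => simp at hj
  | select S I a mem leftmost _ ih =>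
    by_cases hd : Disjoint (Metric.closedBall (O a) R) (Metric.closedBall (O j) R)
    · obtain ⟨i, hi, h⟩ := ih (Finset.mem_filter.2 ⟨hj, hd⟩)
      exact ⟨i, Finset.mem_insert_of_mem hi, h⟩
    · rw [disjoint_closedBall_closedBall_iff hR hR, not_lt] at hd
      exact ⟨a, Finset.mem_insert_self _ _, leftmost j hj, by linarith⟩

end Greedy

/-! ### Geometry of the side curve. -/

/-- Arc-length parametrization of the side curve of the unit disk at the origin, prolonged to
lines. -/
noncomputable def sideArc (s : ℝ) : Plane :=
  let c := max (-(π / 6)) (min s (π / 6))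
  !₂[Real.cos c - (s - c) * Real.sin c, Real.sin c + (s - c) * Real.cos c]

/-- Half of the length of the side curve of a unit disk. -/
noncomputable def sideHalfLength : ℝ := π / 6 + √3 - 1

section SideCurve

theorem sideArc_of_le {s : ℝ} (h : π / 6 ≤ s) :
    sideArc s = !₂[√3 / 2 - (s - π / 6) * (1 / 2), 1 / 2 + (s - π / 6) * (√3 / 2)] := by
  have hpi := Real.pi_pos
  have : max (-(π / 6)) (min s (π / 6)) = π / 6 := by
    rw [min_eq_right h, max_eq_right (by linarith)]
  simp only [sideArc, this, Real.cos_pi_div_six, Real.sin_pi_div_six]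

theorem sideArc_of_le_neg {s : ℝ} (h : s ≤ -(π / 6)) :
    sideArc s = !₂[√3 / 2 + (s + π / 6) * (1 / 2), -(1 / 2) + (s + π / 6) * (√3 / 2)] := by
  have hpi := Real.pi_pos
  have : max (-(π / 6)) (min s (π / 6)) = -(π / 6) := by
    rw [min_eq_left (by linarith), max_eq_left h]
  simp only [sideArc, this, Real.cos_neg, Real.sin_neg, Real.cos_pi_div_six, Real.sin_pi_div_six]
  ext i
  fin_cases i <;> simp

theorem sideArc_of_mem {s : ℝ} (h1 : -(π / 6) ≤ s) (h2 : s ≤ π / 6) :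
    sideArc s = !₂[Real.cos s, Real.sin s] := by
  have : max (-(π / 6)) (min s (π / 6)) = s := by
    rw [min_eq_left h2, max_eq_right h1]
  simp [sideArc, this]

theorem dist_le_of_sq_add_sq_le {x y : Plane} {d : ℝ} (hd : 0 ≤ d)
    (h : (x 0 - y 0) ^ 2 + (x 1 - y 1) ^ 2 ≤ d ^ 2) : dist x y ≤ d := by
  rw [EuclideanSpace.dist_eq, Real.sqrt_le_left hd, Fin.sum_univ_two, Real.dist_eq, Real.dist_eq,
    sq_abs, sq_abs]
  exact h

theorem dist_le_sub_of_glue {f : ℝ → Plane} (c : ℝ)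
    (h1 : ∀ s t, s ≤ t → t ≤ c → dist (f s) (f t) ≤ t - s)
    (h2 : ∀ s t, s ≤ t → c ≤ s → dist (f s) (f t) ≤ t - s) (s t : ℝ) (hst : s ≤ t) :
    dist (f s) (f t) ≤ t - s := by
  rcases le_total t c with htc | htc
  · exact h1 s t hst htc
  rcases le_total s c with hsc | hsc
  · have := dist_triangle (f s) (f c) (f t)
    have := h1 s c hsc le_rfl
    have := h2 c t htc le_rfl
    linarith
  · exact h2 s t hst hsc

theorem dist_sideArc_le_sub (s t : ℝ) (hst : s ≤ t) : dist (sideArc s) (sideArc t) ≤ t - s := by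
  have hpi := Real.pi_pos
  have h3 : √3 ^ 2 = 3 := Real.sq_sqrt (by norm_num)
  refine dist_le_sub_of_glue (-(π / 6)) (fun s t hst ht => ?_) (fun s t hst hs => ?_) s t hst
  · rw [sideArc_of_le_neg ht, sideArc_of_le_neg (hst.trans ht)]
    apply dist_le_of_sq_add_sq_le (by linarith)
    simp
    nlinarith
  -- Clamping the parameter from below extends the arc by a constant, so the gluing lemma applies at
  -- π / 6.
  have aux : ∀ s t, s ≤ t → t ≤ π / 6 → dist (sideArc (max s (-(π / 6))))
      (sideArc (max t (-(π / 6)))) ≤ t - s := by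
    intro s t hst ht
    have hb : ∀ x ≤ π / 6, max x (-(π / 6)) ≤ π / 6 := fun x hx => max_le hx (by linarith)
    rw [sideArc_of_mem (le_max_right _ _) (hb t ht),
      sideArc_of_mem (le_max_right _ _) (hb s (hst.trans ht))]
    have hle : max t (-(π / 6)) - max s (-(π / 6)) ≤ t - s := by
      rcases le_total s (-(π / 6)) with h | h <;> rcases le_total t (-(π / 6)) with h' | h' <;>
        simp only [max_eq_left, max_eq_right, h, h'] <;> linarith
    have hge : max s (-(π / 6)) ≤ max t (-(π / 6)) := max_le_max_right _ hst
    refine (dist_le_of_sq_add_sq_le (sub_nonneg.2 hge) ?_).trans hle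
    set x := max s (-(π / 6))
    set y := max t (-(π / 6))
    have hcos := Real.one_sub_sq_div_two_le_cos (x := y - x)
    rw [Real.cos_sub] at hcos
    simp
    nlinarith [Real.sin_sq_add_cos_sq x, Real.sin_sq_add_cos_sq y]
  have := dist_le_sub_of_glue (f := fun s => sideArc (max s (-(π / 6)))) (π / 6) aux
    (fun s t hst hs => by
      simp only [max_eq_left (show -(π / 6) ≤ s by linarith),
        max_eq_left (show -(π / 6) ≤ t by linarith)]
      rw [sideArc_of_le hs, sideArc_of_le (hs.trans hst)]
      apply dist_le_of_sq_add_sq_le (by linarith)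
      simp
      nlinarith) s t hst
  simpa only [max_eq_left hs, max_eq_left (hs.trans hst)] using this

theorem dist_sideArc_le (s t : ℝ) : dist (sideArc s) (sideArc t) ≤ |s - t| := by
  rcases le_total s t with h | h
  · rw [abs_sub_comm, abs_of_nonneg (sub_nonneg.2 h)]
    exact dist_sideArc_le_sub s t h
  · rw [abs_of_nonneg (sub_nonneg.2 h), dist_comm]
    exact dist_sideArc_le_sub t s h

/-- This makes ordering points by height the same as ordering them by arc length. -/
theorem strictMono_sideArc : StrictMono fun s => sideArc s 1 := by
  have hpi := Real.pi_pos
  have h3 : 0 < √3 := by positivity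
  have hlow : StrictMonoOn (fun s => sideArc s 1) (Set.Iic (-(π / 6))) := by
    intro s hs t ht hst
    simp only [sideArc_of_le_neg (Set.mem_Iic.1 hs), sideArc_of_le_neg (Set.mem_Iic.1 ht)]
    simp
    nlinarith
  have hmid : StrictMonoOn (fun s => sideArc s 1) (Set.Icc (-(π / 6)) (π / 6)) := by
    intro s hs t ht hst
    simp only [sideArc_of_mem hs.1 hs.2, sideArc_of_mem ht.1 ht.2]
    simp
    exact Real.strictMonoOn_sin ⟨by linarith [hs.1], by linarith [hs.2]⟩
      ⟨by linarith [ht.1], by linarith [ht.2]⟩ hst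
  have hup : StrictMonoOn (fun s => sideArc s 1) (Set.Ici (π / 6)) := by
    intro s hs t ht hst
    simp only [sideArc_of_le (Set.mem_Ici.1 hs), sideArc_of_le (Set.mem_Ici.1 ht)]
    simp
    nlinarith
  have hle : -(π / 6) ≤ π / 6 := by linarith
  have h1 : StrictMonoOn (fun s => sideArc s 1) (Set.Iic (π / 6)) := by
    have := hlow.union hmid (c := -(π / 6)) ⟨Set.mem_Iic.2 le_rfl, fun _ h => h⟩
      ⟨Set.left_mem_Icc.2 hle, fun _ h => h.1⟩
    rwa [Set.Iic_union_Icc_eq_Iic hle] at this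
  exact h1.Iic_union_Ici hup

theorem dist_sideArc_ends :
    dist (sideArc sideHalfLength) (sideArc (-sideHalfLength)) = 4 - √3 := by
  have hs1 : 1 < √3 := by rw [Real.lt_sqrt] <;> norm_num
  have hs2 : √3 < 2 := by rw [Real.sqrt_lt'] <;> norm_num
  have h3 : √3 ^ 2 = 3 := Real.sq_sqrt (by norm_num)
  rw [sideArc_of_le (by unfold sideHalfLength; linarith),
    sideArc_of_le_neg (by unfold sideHalfLength; linarith), EuclideanSpace.dist_eq,
    Fin.sum_univ_two, Real.dist_eq, Real.dist_eq, sq_abs, sq_abs]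
  rw [Real.sqrt_eq_iff_mul_self_eq_of_pos (by linarith)]
  simp [sideHalfLength]
  ring_nf
  nlinarith

theorem exists_sideArc_of_mem_sideCurve {o p : Plane} {R : ℝ} (hR : 0 < R)
    (hp : p ∈ sideCurve o R) :
    ∃ s, -sideHalfLength ≤ s ∧ s ≤ sideHalfLength ∧ p = o + R • sideArc s := by
  have hpi := Real.pi_pos
  have hs1 : 1 < √3 := by rw [Real.lt_sqrt] <;> norm_num
  have h3 : √3 ^ 2 = 3 := Real.sq_sqrt (by norm_num)
  rcases hp with (⟨h1, h2⟩ | h) | h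
  · set x := (p 0 - o 0) / R with hx
    set y := (p 1 - o 1) / R with hy
    have hxp : p 0 = o 0 + R * x := by rw [hx]; field_simp; ring
    have hyp : p 1 = o 1 + R * y := by rw [hy]; field_simp; ring
    have hsq : x ^ 2 + y ^ 2 = 1 := by
      rw [mem_sphere_iff_norm, EuclideanSpace.norm_eq, Real.sqrt_eq_iff_mul_self_eq_of_pos hR,
        Fin.sum_univ_two, Real.norm_eq_abs, Real.norm_eq_abs, sq_abs, sq_abs] at h1
      simp only [PiLp.sub_apply, hxp, hyp] at h1
      have : R ^ 2 * (x ^ 2 + y ^ 2 - 1) = 0 := by linarith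
      rcases mul_eq_zero.1 this with h | h
      · exact absurd h (by positivity)
      · linarith
    have hx2 : √3 / 2 ≤ x := by
      rw [hxp] at h2
      have : R * (√3 / 2) ≤ R * x := by linarith
      exact le_of_mul_le_mul_left this hR
    have hyb : y ^ 2 ≤ (1 / 2) ^ 2 := by nlinarith
    obtain ⟨hy1, hy2⟩ := abs_le_of_sq_le_sq' hyb (by norm_num)
    have ha1 : -(π / 6) ≤ Real.arcsin y := by
      rw [Real.le_arcsin_iff_sin_le ⟨by linarith, by linarith⟩ ⟨by linarith, by linarith⟩,
        Real.sin_neg, Real.sin_pi_div_six]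
      exact hy1
    have ha2 : Real.arcsin y ≤ π / 6 := by
      rw [Real.arcsin_le_iff_le_sin ⟨by linarith, by linarith⟩ ⟨by linarith, by linarith⟩,
        Real.sin_pi_div_six]
      exact hy2
    refine ⟨Real.arcsin y, by unfold sideHalfLength; linarith, by unfold sideHalfLength; linarith, ?_⟩
    rw [sideArc_of_mem ha1 ha2, Real.sin_arcsin (by linarith) (by linarith), Real.cos_arcsin]
    have hcos : √(1 - y ^ 2) = x := by
      rw [Real.sqrt_eq_iff_mul_self_eq_of_pos (by linarith)]; linarith
    rw [hcos]
    ext i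
    fin_cases i
    · simp [hxp]
    · simp [hyp]
  · rw [segment_eq_image'] at h
    obtain ⟨t, ⟨ht0, ht1⟩, rfl⟩ := h
    refine ⟨π / 6 + t * (√3 - 1), by unfold sideHalfLength; nlinarith,
      by unfold sideHalfLength; nlinarith, ?_⟩
    rw [sideArc_of_le (by nlinarith)]
    ext i
    fin_cases i
    · simp; ring
    · simp; ring_nf; rw [h3]; ring
  · rw [segment_eq_image'] at h
    obtain ⟨t, ⟨ht0, ht1⟩, rfl⟩ := h
    refine ⟨-(π / 6 + t * (√3 - 1)), by unfold sideHalfLength; nlinarith,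
      by unfold sideHalfLength; nlinarith, ?_⟩
    rw [sideArc_of_le_neg (by nlinarith)]
    ext i
    fin_cases i
    · simp; ring
    · simp; ring_nf; rw [h3]; ring

theorem sq_add_sq_le_one_of_mem_sector {X Y : ℝ} (hXY : X ^ 2 + Y ^ 2 ≤ 4) (hYX : Y ≤ √3 * X)
    (hYc : √3 - 1 ≤ Y) : (X - 1) ^ 2 + (Y - (√3 - 1)) ^ 2 ≤ 1 := by
  have hs1 : 1.73 < √3 := by rw [Real.lt_sqrt] <;> norm_num
  have hs2 : √3 < 1.74 := by rw [Real.sqrt_lt'] <;> norm_num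
  have h3 : √3 ^ 2 = 3 := Real.sq_sqrt (by norm_num)
  rcases le_total X 1 with hX1 | hX1
  · have h1 : (Y - (√3 - 1)) ^ 2 ≤ (√3 * X - (√3 - 1)) ^ 2 := by
      apply pow_le_pow_left₀ <;> linarith
    nlinarith
  · have hY3 : Y ≤ √3 := by
      apply abs_le_of_sq_le_sq' _ (by positivity) |>.2
      nlinarith
    -- X = K is the radical axis of the circle of radius 2 about the origin and the unit circle
    -- about (1, √3 - 1). To its right the power with respect to the unit circle is at most that of
    -- the large circle. To its left X² - 2X increases for X ≥ 1, so it suffices to check X = K.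
    set K := 4 - √3 - (√3 - 1) * Y with hK
    have hK2 : K ^ 2 + Y ^ 2 ≤ 4 := by
      have hf : K ^ 2 + Y ^ 2 - 4 = (Y - √3) * ((5 - 2 * √3) * Y - (5 * √3 - 8)) := by
        rw [hK]; linear_combination (Y ^ 2 - 4) * h3
      have : 0 ≤ (5 - 2 * √3) * Y - (5 * √3 - 8) := by nlinarith
      nlinarith
    rcases le_total K X with h | h
    · nlinarith
    · have : X ^ 2 - 2 * X ≤ K ^ 2 - 2 * K := by nlinarith
      nlinarith

/-- Every disk whose center is at distance at most `2` to the right of a unit disk meets the upper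
or lower half of its side curve. -/
theorem exists_near_unit_sideCurve {a b : ℝ} (ha : 0 ≤ a) (hb : 0 ≤ b) (hab : a ^ 2 + b ^ 2 ≤ 4) :
    ∃ x y : ℝ, (a - x) ^ 2 + (b - y) ^ 2 ≤ 1 ∧ (x ^ 2 + y ^ 2 = 1 ∧ √3 / 2 ≤ x ∨
      ∃ t : ℝ, 0 ≤ t ∧ t ≤ 1 ∧ x = √3 / 2 + t * (1 / 2 - √3 / 2) ∧
        y = 1 / 2 + t * (2 - √3 / 2 - 1 / 2)) := by
  have hs1 : 1.73 < √3 := by rw [Real.lt_sqrt] <;> norm_num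
  have hs2 : √3 < 1.74 := by rw [Real.sqrt_lt'] <;> norm_num
  have h3 : √3 ^ 2 = 3 := Real.sq_sqrt (by norm_num)
  -- Directions within π / 6: project radially to the arc, at distance |r - 1| ≤ 1.
  rcases le_or_gt (√3 * b) a with hle | hgt
  · rcases eq_or_lt_of_le ha with rfl | ha0
    · have : b = 0 := by nlinarith
      subst this
      exact ⟨1, 0, by norm_num, Or.inl ⟨by norm_num, by linarith⟩⟩
    set r := √(a ^ 2 + b ^ 2) with hr
    have hrpos : 0 < r := Real.sqrt_pos.2 (by positivity)
    have hr2 : r ^ 2 = a ^ 2 + b ^ 2 := Real.sq_sqrt (by positivity)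
    have hr4 : r ≤ 2 := by nlinarith
    refine ⟨a / r, b / r, ?_, Or.inl ⟨?_, ?_⟩⟩
    · have h1 : (a - a / r) ^ 2 + (b - b / r) ^ 2 = (a ^ 2 + b ^ 2) * (1 - 1 / r) ^ 2 := by
        field_simp
      rw [h1, ← hr2, ← mul_pow, mul_sub, mul_one, mul_one_div_cancel hrpos.ne']
      nlinarith
    · rw [div_pow, div_pow, ← add_div, ← hr2, div_self (by positivity)]
    · rw [div_le_div_iff₀ (by norm_num) hrpos]
      apply abs_le_of_sq_le_sq' _ (by positivity) |>.2
      rw [mul_pow, mul_pow, hr2, h3]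
      have : (√3 * b) ^ 2 ≤ a ^ 2 := by gcongr
      rw [mul_pow, h3] at this
      linarith
  · -- coordinates along the normal and the tangent at the end of the arc
    obtain ⟨X, hX⟩ : ∃ X, X = a * (√3 / 2) + b / 2 := ⟨_, rfl⟩
    obtain ⟨Y, hY⟩ : ∃ Y, Y = b * (√3 / 2) - a / 2 := ⟨_, rfl⟩
    have haX : a = X * (√3 / 2) - Y / 2 := by rw [hX, hY]; linear_combination -(a / 4) * h3
    have hbY : b = X / 2 + Y * (√3 / 2) := by rw [hX, hY]; linear_combination -(b / 4) * h3
    have hY0 : 0 < Y := by rw [hY]; linarith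
    have hX0 : 0 ≤ X := by rw [hX]; positivity
    have hXY : X ^ 2 + Y ^ 2 ≤ 4 := by
      have : X ^ 2 + Y ^ 2 = a ^ 2 + b ^ 2 := by
        rw [hX, hY]; linear_combination ((a ^ 2 + b ^ 2) / 4) * h3
      linarith
    have hYX : Y ≤ √3 * X := by
      have : √3 * X - Y = 2 * a := by rw [hX, hY]; linear_combination (a / 2) * h3
      linarith
    -- Up to the end of the tangent segment the perpendicular foot works, at distance |X - 1| ≤ 1;
    -- beyond it the end of the segment works.
    rcases le_or_gt Y (√3 - 1) with hYc | hYc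
    · refine ⟨√3 / 2 - Y / 2, 1 / 2 + Y * (√3 / 2), ?_, Or.inr ⟨Y / (√3 - 1),
        div_nonneg hY0.le (by linarith), (div_le_one (by linarith)).2 hYc, ?_, ?_⟩⟩
      · have : (a - (√3 / 2 - Y / 2)) ^ 2 + (b - (1 / 2 + Y * (√3 / 2))) ^ 2 = (X - 1) ^ 2 := by
          rw [haX, hbY]; linear_combination ((X - 1) ^ 2 / 4) * h3
        rw [this]
        have hX2 : X ≤ 2 := by
          apply abs_le_of_sq_le_sq' _ (by norm_num) |>.2
          linarith [sq_nonneg Y]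
        linarith [mul_nonneg hX0 (sub_nonneg.2 hX2)]
      · have : √3 - 1 ≠ 0 := by linarith
        field_simp; ring
      · have : √3 - 1 ≠ 0 := by linarith
        field_simp; linear_combination Y * h3
    · refine ⟨1 / 2, 2 - √3 / 2, ?_, Or.inr ⟨1, by norm_num, le_rfl, by ring, by ring⟩⟩
      have hid : (a - 1 / 2) ^ 2 + (b - (2 - √3 / 2)) ^ 2 =
          (X - 1) ^ 2 + (Y - (√3 - 1)) ^ 2 := by
        rw [haX, hbY]
        linear_combination ((X ^ 2 + Y ^ 2) / 4 - 3 / 4 + Y / 2) * h3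
      rw [hid]
      exact sq_add_sq_le_one_of_mem_sector hXY hYX hYc.le

theorem exists_mem_sideCurve_dist_le {o q : Plane} {R : ℝ} (hR : 0 < R) (hle : o 0 ≤ q 0)
    (hd : dist o q ≤ 2 * R) : ∃ p ∈ sideCurve o R, dist p q ≤ R := by
  obtain ⟨a, ha⟩ : ∃ a, q 0 = o 0 + R * a := ⟨(q 0 - o 0) / R, by field_simp; ring⟩
  obtain ⟨b, hb⟩ : ∃ b, q 1 = o 1 + R * b := ⟨(q 1 - o 1) / R, by field_simp; ring⟩
  have ha0 : 0 ≤ a := by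
    have : 0 ≤ R * a := by linarith
    exact nonneg_of_mul_nonneg_right this hR
  have hab : a ^ 2 + b ^ 2 ≤ 4 := by
    rw [EuclideanSpace.dist_eq, Real.sqrt_le_left (by positivity), Fin.sum_univ_two, Real.dist_eq,
      Real.dist_eq, sq_abs, sq_abs, ha, hb] at hd
    have : R ^ 2 * (a ^ 2 + b ^ 2) ≤ R ^ 2 * 4 := by linarith
    exact le_of_mul_le_mul_left this (by positivity)
  have hdist : ∀ x y : ℝ, (a - x) ^ 2 + (b - y) ^ 2 ≤ 1 → dist (o + R • !₂[x, y]) q ≤ R := by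
    intro x y h
    apply dist_le_of_sq_add_sq_le hR.le
    simp [ha, hb]
    have : R ^ 2 * ((a - x) ^ 2 + (b - y) ^ 2) ≤ R ^ 2 * 1 := by gcongr
    linarith
  have harc : ∀ x y : ℝ, x ^ 2 + y ^ 2 = 1 → √3 / 2 ≤ x → o + R • !₂[x, y] ∈ sideCurve o R := by
    intro x y h1 h2
    refine Or.inl (Or.inl ⟨?_, ?_⟩)
    · rw [mem_sphere_iff_norm, EuclideanSpace.norm_eq, Real.sqrt_eq_iff_mul_self_eq_of_pos hR,
        Fin.sum_univ_two, Real.norm_eq_abs, Real.norm_eq_abs, sq_abs, sq_abs]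
      simp
      linear_combination -(R ^ 2) * h1
    · simp
      nlinarith
  rcases le_total 0 b with hb0 | hb0
  · obtain ⟨x, y, h, h' | ⟨t, ht0, ht1, hx, hy⟩⟩ := exists_near_unit_sideCurve ha0 hb0 hab
    · exact ⟨_, harc x y h'.1 h'.2, hdist x y h⟩
    · refine ⟨_, Or.inl (Or.inr ?_), hdist x y h⟩
      rw [segment_eq_image']
      refine ⟨t, ⟨ht0, ht1⟩, ?_⟩
      ext i
      fin_cases i
      · simp [hx]; ring
      · simp [hy]; ring
  · obtain ⟨x, y, h, h' | ⟨t, ht0, ht1, hx, hy⟩⟩ :=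
      exists_near_unit_sideCurve ha0 (neg_nonneg.2 hb0) (by rwa [neg_sq])
    · exact ⟨_, harc x (-y) (by rw [neg_sq]; exact h'.1) h'.2, hdist x (-y) (by linarith)⟩
    · refine ⟨_, Or.inr ?_, hdist x (-y) (by linarith)⟩
      rw [segment_eq_image']
      refine ⟨t, ⟨ht0, ht1⟩, ?_⟩
      ext i
      fin_cases i
      · simp [hx]; ring
      · simp [hy]; ring

end SideCurve

/-! ### The walk through the side curves. -/

section Augmentation

/-- Direction in which the `c`-th side curve is run through. -/
noncomputable def runSign (c : ℕ) : ℝ := if Even c then -1 else 1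

/-- The point reached after length `D` (in units of `R`) on the side curve of the `c`-th center. -/
noncomputable def runPoint (o : ℕ → Plane) (R : ℝ) (c : ℕ) (D : ℝ) : Plane :=
  o c + R • sideArc (runSign c * (D - sideHalfLength))

/-- Length of the walk through the side curves up to the start of the `c`-th one. -/
noncomputable def runLength (o : ℕ → Plane) (R : ℝ) (c : ℕ) : ℝ :=
  ∑ i ∈ Finset.range c, (dist (o i) (o (i + 1)) + 2 * sideHalfLength * R)

variable {o : ℕ → Plane} {R : ℝ}

theorem runSign_succ (c : ℕ) : runSign (c + 1) = -runSign c := by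
  unfold runSign
  by_cases h : Even c <;> simp [h, Nat.even_add_one]

theorem runSign_eq_or (c : ℕ) : runSign c = -1 ∨ runSign c = 1 := by
  unfold runSign
  split_ifs <;> simp

theorem sideHalfLength_pos : 0 < sideHalfLength := by
  have hpi := Real.pi_pos
  have hs1 : 1 < √3 := by rw [Real.lt_sqrt] <;> norm_num
  unfold sideHalfLength
  linarith

theorem dist_runPoint_le_abs (hR : 0 ≤ R) (c : ℕ) (D D' : ℝ) :
    dist (runPoint o R c D) (runPoint o R c D') ≤ R * |D - D'| := by
  rw [runPoint, runPoint, dist_add_left, dist_smul₀, Real.norm_of_nonneg hR]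
  refine mul_le_mul_of_nonneg_left ((dist_sideArc_le _ _).trans (le_of_eq ?_)) hR
  rw [← mul_sub, abs_mul, sub_sub_sub_cancel_right]
  rcases runSign_eq_or c with h | h <;> simp [h]

/-- Directions alternate, so the end of one curve and the start of the next have the same position
relative to their centers. -/
theorem dist_runPoint_end_succ (c : ℕ) :
    dist (runPoint o R c (2 * sideHalfLength)) (runPoint o R (c + 1) 0) =
      dist (o c) (o (c + 1)) := by
  have : runSign c * (2 * sideHalfLength - sideHalfLength) =
      runSign (c + 1) * (0 - sideHalfLength) := by
    rw [runSign_succ]; ring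
  rw [runPoint, runPoint, this, dist_add_right]

theorem runLength_succ (c : ℕ) : runLength o R (c + 1) =
    runLength o R c + (dist (o c) (o (c + 1)) + 2 * sideHalfLength * R) :=
  Finset.sum_range_succ _ _

theorem dist_runPoint_start_le (hR : 0 ≤ R) {c c' : ℕ} (h : c ≤ c') :
    dist (runPoint o R c 0) (runPoint o R c' 0) ≤ runLength o R c' - runLength o R c := by
  induction c', h using Nat.le_induction with
  | base => simp
  | succ m _ ih =>
    have h1 := dist_triangle4 (runPoint o R c 0) (runPoint o R m 0)
      (runPoint o R m (2 * sideHalfLength)) (runPoint o R (m + 1) 0)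
    have h2 := dist_runPoint_le_abs (o := o) hR m 0 (2 * sideHalfLength)
    rw [abs_sub_comm, sub_zero, abs_of_nonneg (by linarith [sideHalfLength_pos])] at h2
    rw [dist_runPoint_end_succ] at h1
    rw [runLength_succ]
    linarith

theorem dist_runPoint_le_of_lt (hR : 0 ≤ R) {c c' : ℕ} {D D' : ℝ} (h : c < c')
    (hD : D ≤ 2 * sideHalfLength) (hD' : 0 ≤ D') :
    dist (runPoint o R c D) (runPoint o R c' D') ≤
      runLength o R c' + R * D' - (runLength o R c + R * D) := by
  have h1 := dist_triangle4 (runPoint o R c D) (runPoint o R c (2 * sideHalfLength))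
    (runPoint o R (c + 1) 0) (runPoint o R c' 0)
  have h2 := dist_triangle (runPoint o R c D) (runPoint o R c' 0) (runPoint o R c' D')
  have h3 := dist_runPoint_le_abs (o := o) hR c D (2 * sideHalfLength)
  have h4 := dist_runPoint_le_abs (o := o) hR c' 0 D'
  have h5 := dist_runPoint_start_le (o := o) hR (Nat.succ_le_of_lt h)
  rw [Nat.succ_eq_add_one, runLength_succ] at h5
  rw [dist_runPoint_end_succ] at h1
  rw [abs_sub_comm, abs_of_nonneg (by linarith)] at h3
  rw [abs_sub_comm, sub_zero, abs_of_nonneg hD'] at h4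
  linarith

/-- Used to close the walk: for an odd number of curves it returns to the opposite end of the first
curve, which costs the distance between the ends. -/
theorem dist_runPoint_starts_le (hR : 0 ≤ R) {c c' : ℕ} (h : o c = o c') :
    dist (runPoint o R c 0) (runPoint o R c' 0) ≤ (4 - √3) * R := by
  have hs2 : √3 < 2 := by rw [Real.sqrt_lt'] <;> norm_num
  rw [runPoint, runPoint, h, dist_add_left, dist_smul₀, Real.norm_of_nonneg hR, mul_comm]
  refine mul_le_mul_of_nonneg_right ?_ hR
  have hends := dist_sideArc_ends
  have hends' := (dist_comm _ _).trans hends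
  rcases runSign_eq_or c with h1 | h1 <;> rcases runSign_eq_or c' with h2 | h2 <;>
    simp [h1, h2, hends, hends'] <;> linarith

end Augmentation

/-! ### Existence and length of the augmented tour. -/

section AugmentedTour

variable {ι : Type*} [Fintype ι] {O : ι → Plane} {R : ℝ} {I : Finset ι}

theorem sum_range_dist_eq_cycleLength {k : ℕ} (p : Fin k → Plane) (o : ℕ → Plane)
    (ho : ∀ i : Fin k, o i = p i) (hk : o k = o 0) :
    ∑ i ∈ Finset.range k, dist (o i) (o (i + 1)) = cycleLength p := by
  obtain _ | m := k
  · simp [cycleLength]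
  · rw [cycleLength_eq_sum_range p o ho, Finset.sum_range_succ, hk]

theorem IsAugmentation.length_le (hR : 0 < R) {τ : VisitOrder I} {T : TSPNTour O R}
    (hT : IsAugmentation τ T) :
    T.length ≤ tspLength (fun i : I => O i) τ +
      (2 * (π / 6 + √3 - 1) * Fintype.card I + (4 - √3)) * R := by
  have hs2 : √3 < 2 := by rw [Real.sqrt_lt'] <;> norm_num
  have hh := sideHalfLength_pos
  change _ ≤ _ + (2 * sideHalfLength * _ + _) * R
  obtain ⟨pos, hcurve, hord⟩ := hT
  have hC0 : 0 ≤ tspLength (fun i : I => O i) τ +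
      (2 * sideHalfLength * (Fintype.card I) + (4 - √3)) * R := by
    have h1 : 0 ≤ tspLength (fun i : I => O i) τ := cycleLength_nonneg _
    have h2 : 0 ≤ 4 - √3 := by linarith
    positivity
  rcases isEmpty_or_nonempty ι with hι | ⟨⟨j₀⟩⟩
  · refine le_trans (le_of_eq ?_) hC0
    unfold TSPNTour.length cycleLength
    exact Finset.sum_eq_zero fun s _ => hι.elim (T.order s)
  have hk : 0 < Fintype.card I := (Nat.zero_le _).trans_lt (pos j₀).2
  -- The sequence of centers is continued by a copy of the first one at index k, so the closing edge
  -- of the TSP tour becomes an ordinary step of the walk.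
  obtain ⟨o, ho, hok⟩ : ∃ o : ℕ → Plane, (∀ i : Fin (Fintype.card I), o i = O (τ i)) ∧
      o (Fintype.card I) = o 0 :=
    ⟨fun i => if h : i < Fintype.card I then O (τ ⟨i, h⟩) else O (τ ⟨0, hk⟩), fun i => dif_pos i.2,
      by simp⟩
  have hlen : runLength o R (Fintype.card I) =
      tspLength (fun i : I => O i) τ + 2 * sideHalfLength * (Fintype.card I) * R := by
    rw [runLength, Finset.sum_add_distrib,
      sum_range_dist_eq_cycleLength (fun i => O (τ i)) o ho hok]
    simp only [Finset.sum_const, Finset.card_range, nsmul_eq_mul, tspLength]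
    ring
  choose s hs1 hs2 hs3 using fun j => exists_sideArc_of_mem_sideCurve hR (hcurve j)
  set D : ι → ℝ := fun j => sideHalfLength + runSign (pos j) * s j with hD
  have hpoint : ∀ j, T.point j = runPoint o R (pos j) (D j) := by
    intro j
    have : runSign (pos j) * (D j - sideHalfLength) = s j := by
      rcases runSign_eq_or (pos j) with h | h <;> simp [hD, h]
    rw [runPoint, this, ho, ← hs3]
  have hD0 : ∀ j, 0 ≤ D j ∧ D j ≤ 2 * sideHalfLength := by
    intro j
    have h1 := hs1 j
    have h2 := hs2 j
    rcases runSign_eq_or (pos j) with h | h <;> simp only [hD, h] <;> constructor <;> linarith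
  -- The potential is the distance walked until the point is met.
  refine cycleLength_le_of_potential _
    (fun t => runLength o R (pos (T.order t)) + R * D (T.order t)) hC0 (fun a b hab => ?_)
    fun a b _ => ?_
  · simp only [hpoint]
    rcases hord a b hab with h | ⟨h, hy⟩
    · exact dist_runPoint_le_of_lt hR.le (Fin.lt_def.1 h) (hD0 _).2 (hD0 _).1
    · have hDle : D (T.order a) ≤ D (T.order b) := by
        have hmono : ∀ i j, pos i = pos j → T.point i 1 ≤ T.point j 1 → s i ≤ s j := by
          intro i j hij hle
          rw [hs3 i, hs3 j, hij] at hle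
          simp only [PiLp.add_apply, PiLp.smul_apply, smul_eq_mul, add_le_add_iff_left] at hle
          exact strictMono_sideArc.le_iff_le.1 (le_of_mul_le_mul_left hle hR)
        rw [h] at hy
        simp only [hD, h, runSign]
        split_ifs at hy ⊢ with he
        · have := hmono _ _ h.symm hy
          linarith
        · have := hmono _ _ h hy
          linarith
      rw [← h]
      refine (dist_runPoint_le_abs hR.le _ _ _).trans (le_of_eq ?_)
      rw [abs_sub_comm, abs_of_nonneg (sub_nonneg.2 hDle)]
      ring
  · simp only [hpoint]
    have h1 := dist_runPoint_le_of_lt (o := o) hR.le (pos (T.order b)).2 (hD0 (T.order b)).2 le_rfl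
    have h2 := dist_runPoint_starts_le hR.le hok
    have h3 := dist_runPoint_start_le (o := o) hR.le (Nat.zero_le (pos (T.order a)))
    have h4 := dist_runPoint_le_abs (o := o) hR.le (pos (T.order a)) 0 (D (T.order a))
    rw [abs_sub_comm, sub_zero, abs_of_nonneg (hD0 _).1] at h4
    have h5 := dist_triangle4 (runPoint o R (pos (T.order b)) (D (T.order b)))
      (runPoint o R (Fintype.card I) 0) (runPoint o R 0 0) (runPoint o R (pos (T.order a)) 0)
    have h6 := dist_triangle (runPoint o R (pos (T.order b)) (D (T.order b)))
      (runPoint o R (pos (T.order a)) 0) (runPoint o R (pos (T.order a)) (D (T.order a)))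
    have h7 : runLength o R 0 = 0 := by simp [runLength]
    linarith

theorem exists_isAugmentation (hR : 0 < R) (hI : GreedyDisjoint O R Finset.univ I)
    (τ : VisitOrder I) : ∃ T : TSPNTour O R, IsAugmentation τ T := by
  have hex : ∀ j, ∃ i : I, ∃ p ∈ sideCurve (O i) R, dist p (O j) ≤ R := fun j => by
    obtain ⟨i, hi, h1, h2⟩ := hI.exists_near hR.le (Finset.mem_univ j)
    exact ⟨⟨i, hi⟩, exists_mem_sideCurve_dist_le hR h1 h2⟩
  choose c p hp hd using hex
  -- The lexicographic key is the curve first, then the height, negated on curves run downwards.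
  obtain ⟨σ, hσ⟩ := exists_visitOrder_monotone fun j =>
    toLex (τ.symm (c j), if Even (τ.symm (c j) : ℕ) then -(p j 1) else p j 1)
  refine ⟨⟨σ, p, hd⟩, fun j => τ.symm (c j), fun j => by simpa using hp j, fun a b hab => ?_⟩
  rcases Prod.Lex.toLex_le_toLex.1 (hσ hab.le) with h | ⟨h1, h2⟩
  · exact Or.inl h
  · refine Or.inr ⟨h1, ?_⟩
    have h1' : τ.symm (c (σ a)) = τ.symm (c (σ b)) := h1
    simp only [h1'] at h2 ⊢
    split_ifs at h2 ⊢ with he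
    · exact neg_le_neg_iff.1 h2
    · exact h2

theorem IsAugmentation.length_le_mul_tspnOpt (hR : 0 < R) (hI : GreedyDisjoint O R Finset.univ I)
    {a : ℝ} (ha : 1 ≤ a) {τ : VisitOrder I}
    (hτ : tspLength (fun i : I => O i) τ ≤ a * tspOpt (fun i : I => O i)) {T : TSPNTour O R}
    (hT : IsAugmentation τ T) :
    T.length ≤ 6.728 * a * tspnOpt O R +
      (8 * a + 4 * (2 * (π / 6 + √3 - 1)) + (4 - √3)) * R := by
  obtain ⟨T₀, hT₀⟩ := TSPNTour.exists_isOptimal (fun i : I => O i) hR.le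
  have hL : T₀.length ≤ tspnOpt O R := hT₀.trans_le (tspnOpt_subfamily_le I hR.le)
  have hL0 := T₀.length_nonneg
  have h1 := hT.length_le hR
  have h2 := T₀.tspOpt_le_of_disjoint hR hI.disjointDisks
  have h3 := T₀.pi_mul_card_le_length hR hI.disjointDisks
  have h4 : tspLength (fun i : I => O i) τ ≤ a * (3.53 * tspnOpt O R + 8 * R) := by
    refine hτ.trans (mul_le_mul_of_nonneg_left ?_ (by linarith))
    linarith
  have hpi := Real.pi_gt_d4
  have hs1 : 1 < √3 := by rw [Real.lt_sqrt] <;> norm_num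
  have hs2 : √3 < 1.73206 := by rw [Real.sqrt_lt'] <;> norm_num
  set k : ℝ := (Fintype.card I : ℝ)
  -- The count k ≤ 4 + 4L / (πR) is multiplied by A R; 3.198 is an upper bound for 4A / π.
  have h5 : 2 * (π / 6 + √3 - 1) * k * R ≤
      4 * (2 * (π / 6 + √3 - 1)) * R + 3.198 * tspnOpt O R := by
    have h6 : 2 * (π / 6 + √3 - 1) * (π * k * R) ≤
        2 * (π / 6 + √3 - 1) * (4 * π * R + 4 * tspnOpt O R) := by
      apply mul_le_mul_of_nonneg_left <;> linarith
    have h7 : 2 * (π / 6 + √3 - 1) * 4 ≤ 3.198 * π := by linarith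
    have h8 := mul_le_mul_of_nonneg_right h7 (hL0.trans hL)
    refine le_of_mul_le_mul_left (a := π) ?_ Real.pi_pos
    linarith
  have h9 : tspnOpt O R ≤ a * tspnOpt O R := le_mul_of_one_le_left (hL0.trans hL) ha
  linarith

end AugmentedTour

theorem theorem1 {ι : Type*} [Fintype ι] (O : ι → Plane) (R : ℝ) (hR : 0 < R) :
    -- the trichotomy for at least four disjoint disks
    (DisjointDisks O R → 4 ≤ Fintype.card ι →
      ∀ T : TSPNTour O R, T.IsOptimal →
        T.SupportedByLine ∨
        tspOpt O ≤ tspnOpt O R + 1.999 * R * (Fintype.card ι : ℝ) ∨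
        tspOpt O ≤ 2 * tspnOpt O R) ∧
    -- disjoint disks: an `a`-approximate TSP tour on the centers
    (DisjointDisks O R →
      ∀ a : ℝ, 1 ≤ a → ∀ τ : VisitOrder ι, tspLength O τ ≤ a * tspOpt O →
        tspLength O τ ≤ 3.53 * a * tspnOpt O R + 8 * a * R) ∧
    -- arbitrary disks: greedy selection, `a`-approximate TSP tour on its centers, augmentation
    (∀ I : Finset ι, GreedyDisjoint O R Finset.univ I →
      ∀ a : ℝ, 1 ≤ a → ∀ τ : VisitOrder I,
        tspLength (fun i : I => O i) τ ≤ a * tspOpt (fun i : I => O i) →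
        (∃ T : TSPNTour O R, IsAugmentation τ T) ∧
        ∀ T : TSPNTour O R, IsAugmentation τ T →
          T.length ≤ 6.728 * a * tspnOpt O R +
            (8 * a + 4 * (2 * (π / 6 + √3 - 1)) + (4 - √3)) * R) := by
  refine ⟨fun h hn T hT => Or.inr (hT.tspOpt_le hR h (by omega)), fun h a ha τ hτ => ?_,
    fun I hI a ha τ hτ => ⟨exists_isAugmentation hR hI τ, fun T hT =>
      hT.length_le_mul_tspnOpt hR hI ha hτ⟩⟩
  obtain ⟨T, hT⟩ := TSPNTour.exists_isOptimal O hR.le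
  have h1 := T.tspOpt_le_of_disjoint hR h
  rw [show T.length = tspnOpt O R from hT] at h1
  have h2 := mul_le_mul_of_nonneg_left h1 (zero_le_one.trans ha)
  linarith
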